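/- **Setting.** For each $n$ let $d_n\in\mathbb N$, let $g_n:(\mathbb R^{d_n})^n\to\mathbb R$ be measurable, let $f_n:(\mathbb R^{d_n})^n\to\mathbb R$ be three times continuously differentiable, let $\mathcal P_n$ be a set of probability measures $\nu$ on $\mathbb R^{d_n}$ with $\mathbb E_{X\sim\nu}\|X\|^{12}<\infty$, and let $A_n\subset\mathbb R^{d_n}$. For $\nu\in\mathcal P_n$ write $m_\nu=\mathbb E_{X\sim\nu}[X]$; let $X^n=(X_1,\dots,X_n)$ and $Y^n=(Y_1,\dots,Y_n)$ be independent samples of i.i.d. vectors with law $\nu$; let $\bar X^n=\frac1n\sum_{i}X_i$; and let $Z^n=(X_{J_1},\dots,X_{J_n})$ be a bootstrap sample, where $J_1,\dots,J_n$ are i.i.d. uniform on $\{1,\dots,n\}$ and independent of $(X^n,Y^n)$. For $x_{1:n}=(x_1,\dots,x_n)$ and $c\in\mathbb R^{d_n}$ put $x_{1:n}+c=(x_1+c,\dots,x_n+c)$. Let $\tilde Z^n=Z^n+m_\nu-\bar X^n$, $\tilde Y^n=Y^n+\bar X^n-m_\nu$, and $Z^{n,i,v}=(\tilde Y_1,\dots,\tilde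 Y_{i-1},v,Z_{i+1},\dots,Z_n)$ for $v\in\mathbb R^{d_n}$. Write $[a,b]$ for the segment joining $a$ and $b$, $\partial_{i,k}$ for the partial derivative in the $k$-th coordinate of the $i$-th argument, $\|\cdot\|_{L_{12}}$ for the $L_{12}$ norm of a random variable, and $M_k=2\|X_{1,k}\|_{L_{12}}$. With the random function $F_n(x_{1:n})=f_n(x_{1:n}+m_\nu-\bar X^n)$, define $$R^{c,\nu}_{n,1}=n^{1/3}\sum_{k}M_k\max_{i\le n}\big\|\partial_{i,k}F_n(Z^{n,i,\bar X^n})\big\|_{L_{12}},$$ $$R^{c,\nu}_{n,2}=n^{1/2}\sum_{k_1,k_2}M_{k_1}M_{k_2}\max_{i\le n}\big\|\partial_{i,k_1}\partial_{i,k_2}F_n(Z^{n,i,\bar X^n})\big\|_{L_{12}},$$ $$R^{c,\nu}_{n,3}=n\sum_{k_1,k_2,k_3}M_{k_1}M_{k_2}M_{k_3}\max_{i\le n}\Big\|\max_{v\in[\bar X^n,\tilde Y_i]\cup[\bar X^n,Z_i]}\big|\partial_{i,k_1}\partial_{i,k_2}\partial_{i,k_3}F_n(Z^{n,i,v})\big|\Big\|_{L_{12}}.$$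 **Theorem.** Suppose that $$(H_0^{\rm rob})\quad \sup_{\nu\in\mathcal P_n}\Big(\mathbb E\big|f_n(\tilde Z^n)-g_n(\tilde Z^n)\big|+\mathbb E\big|f_n(X^n)-g_n(X^n)\big|\Big)\xrightarrow[n\to\infty]{}0,$$ $$(H_1^{\rm rob})\quad \sup_{\nu\in\mathcal P_n}\max\big(R^{c,\nu}_{n,1},R^{c,\nu}_{n,2},R^{c,\nu}_{n,3}\big)\xrightarrow[n\to\infty]{}0.$$ Let $\alpha\ge 0$, and let $t_n^\alpha:(\mathbb R^{d_n})^n\to\mathbb R$ be functions, measurable with respect to the completion of $\nu^{\otimes n}$ for every $\nu\in\mathcal P_n$, such that for every $n$ and every $\nu\in\mathcal P_n$, almost surely for $X^n\sim\nu^{\otimes n}$, $$\sup_{\mu\in A_n}P\Big(\big|g_n(Z^n+\mu-\bar X^n)-\mathbb E[g_n(Z^n+\mu-\bar X^n)\mid X^n]\big|\ge t_n^\alpha(X^n)\;\Big|\;X^n\Big)\le\alpha .$$ Put $\mathcal Q_n=\{\nu\in\mathcal P_n: m_\nu\in A_n\}$. Then, for all sufficiently large $n$, $g_n(Y^n)$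 is integrable for every $\nu\in\mathcal Q_n$, and $$\liminf_{\delta\downarrow0}\ \limsup_{n\to\infty}\ \sup_{\nu\in\mathcal Q_n}P\Big(\big|g_n(Y^n)-\mathbb E[g_n(Y^n)]\big|\ge t_n^\alpha(X^n)+\delta\Big)\le\alpha ,$$ where suprema of probabilities over the empty set are $0$. -/

import Mathlib

open MeasureTheory ProbabilityTheory Filter Topology
open scoped ENNReal

noncomputable section

namespace RobustBootstrap

/-- A sample `(x_1, …, x_n)` of `n` points of `ℝ^d`. -/
abbrev Sample (n d : ℕ) : Type := Fin n → Fin d → ℝ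

/-- The mean `E_{X ∼ ν}[X]`. -/
def mean {d : ℕ} (ν : ProbabilityMeasure (Fin d → ℝ)) : Fin d → ℝ :=
  ∫ x, x ∂(ν : Measure (Fin d → ℝ))

/-- The law `ν^{⊗ n}` of an i.i.d. sample of size `n`. -/
def iidLaw {d : ℕ} (n : ℕ) (ν : ProbabilityMeasure (Fin d → ℝ)) : Measure (Sample n d) :=
  Measure.pi fun _ => (ν : Measure (Fin d → ℝ))

/-- The law of the `n` resampling indices: i.i.d., uniform on the `n` positions. -/
def indexLaw (n : ℕ) : Measure (Fin n → Fin n) :=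
  Measure.pi fun _ => uniformOn (Set.univ : Set (Fin n))

/-- The joint law of `(X, J, Y)`: `X` and `Y` are i.i.d. samples from `ν`, `J` are the resampling
indices, and the three are independent. -/
def jointLaw {d : ℕ} (n : ℕ) (ν : ProbabilityMeasure (Fin d → ℝ)) :
    Measure (Sample n d × (Fin n → Fin n) × Sample n d) :=
  (iidLaw n ν).prod ((indexLaw n).prod (iidLaw n ν))

/-- The empirical mean of a sample. -/
def sampleMean {n d : ℕ} (x : Sample n d) : Fin d → ℝ := (n : ℝ)⁻¹ • ∑ i, x i

/-- `x_{1:n} + c = (x_1 + c, …, x_n + c)`. -/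
def shift {n d : ℕ} (x : Sample n d) (c : Fin d → ℝ) : Sample n d := fun i => x i + c

/-- The bootstrap sample `Z_i = X_{J_i}`. -/
def resample {n d : ℕ} (x : Sample n d) (J : Fin n → Fin n) : Sample n d := fun i => x (J i)

/-- The bootstrap sample recentered at `μ`: `Z_i + μ - X̄`. -/
def centeredResample {n d : ℕ} (μ : Fin d → ℝ) (x : Sample n d) (J : Fin n → Fin n) :
    Sample n d :=
  shift (resample x J) (μ - sampleMean x)

/-- The copy `Y` recentered at the empirical mean of `X`: `Ỹ_i = Y_i + X̄ - E[X_1]`. -/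
def recenteredCopy {n d : ℕ} (ν : ProbabilityMeasure (Fin d → ℝ)) (x y : Sample n d) :
    Sample n d :=
  shift y (sampleMean x - mean ν)

/-- The interpolation `Z^{n,i,v} = (Ỹ_1, …, Ỹ_{i-1}, v, Z_{i+1}, …, Z_n)`. -/
def interp {n d : ℕ} (ν : ProbabilityMeasure (Fin d → ℝ)) (i : Fin n) (v : Fin d → ℝ)
    (ω : Sample n d × (Fin n → Fin n) × Sample n d) : Sample n d := fun j =>
  if j < i then recenteredCopy ν ω.1 ω.2.2 j
  else if j = i then v
  else resample ω.1 ω.2.1 j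

/-- The partial derivative `∂_{i,k} F = ∂F / ∂x_{i,k}`. -/
def partialD {n d : ℕ} (i : Fin n) (k : Fin d) (F : Sample n d → ℝ) : Sample n d → ℝ :=
  fun x => fderiv ℝ F x (Pi.single i (Pi.single k 1))

/-- `M_k = 2 ‖X_{1,k}‖_{L_12}`. -/
def momentM {d : ℕ} (ν : ProbabilityMeasure (Fin d → ℝ)) (k : Fin d) : ℝ≥0∞ :=
  2 * eLpNorm (fun x : Fin d → ℝ => x k) 12 (ν : Measure (Fin d → ℝ))

/-- `D_k(F)` for a random function `F` of the data: `F x` is the function observed at `X = x`. -/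
def D1 {n d : ℕ} (ν : ProbabilityMeasure (Fin d → ℝ)) (F : Sample n d → Sample n d → ℝ)
    (k : Fin d) : ℝ≥0∞ :=
  momentM ν k * ⨆ i : Fin n,
    eLpNorm (fun ω => partialD i k (F ω.1) (interp ν i (sampleMean ω.1) ω)) 12 (jointLaw n ν)

/-- `D_{k₁,k₂}(F)`. -/
def D2 {n d : ℕ} (ν : ProbabilityMeasure (Fin d → ℝ)) (F : Sample n d → Sample n d → ℝ)
    (k₁ k₂ : Fin d) : ℝ≥0∞ :=
  momentM ν k₁ * momentM ν k₂ * ⨆ i : Fin n,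
    eLpNorm (fun ω => partialD i k₁ (partialD i k₂ (F ω.1)) (interp ν i (sampleMean ω.1) ω)) 12
      (jointLaw n ν)

/-- `D_{k₁,k₂,k₃}(F)`: the maximum of `|∂³_{i,k₁,k₂,k₃} F|` over the `i`-th argument in
`[X̄, Ỹ_i] ∪ [X̄, Z_i]`. (`Z_i` does not occur in `Z^{n,i,v}`, so it may be replaced here by any of
`Z_1, …, Z_i` without changing the law of the maximum.) -/
def D3 {n d : ℕ} (ν : ProbabilityMeasure (Fin d → ℝ)) (F : Sample n d → Sample n d → ℝ)
    (k₁ k₂ k₃ : Fin d) : ℝ≥0∞ :=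
  momentM ν k₁ * momentM ν k₂ * momentM ν k₃ * ⨆ i : Fin n,
    eLpNorm (fun ω => ⨆ v ∈ segment ℝ (sampleMean ω.1) (recenteredCopy ν ω.1 ω.2.2 i) ∪
          segment ℝ (sampleMean ω.1) (resample ω.1 ω.2.1 i),
        ‖partialD i k₁ (partialD i k₂ (partialD i k₃ (F ω.1))) (interp ν i v ω)‖ₑ) 12
      (jointLaw n ν)

/-- The random function `f(· + E[X_1] - X̄)`. -/
def centeredFun {n d : ℕ} (ν : ProbabilityMeasure (Fin d → ℝ)) (f : Sample n d → ℝ) :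
    Sample n d → Sample n d → ℝ :=
  fun x z => f (shift z (mean ν - sampleMean x))

/-- `R^{c,ν}_{n,1}`. -/
def Rc1 {n d : ℕ} (ν : ProbabilityMeasure (Fin d → ℝ)) (f : Sample n d → ℝ) : ℝ≥0∞ :=
  (n : ℝ≥0∞) ^ (1 / 3 : ℝ) * ∑ k, D1 ν (centeredFun ν f) k

/-- `R^{c,ν}_{n,2}`. -/
def Rc2 {n d : ℕ} (ν : ProbabilityMeasure (Fin d → ℝ)) (f : Sample n d → ℝ) : ℝ≥0∞ :=
  (n : ℝ≥0∞) ^ (1 / 2 : ℝ) * ∑ k₁, ∑ k₂, D2 ν (centeredFun ν f) k₁ k₂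

/-- `R^{c,ν}_{n,3}`. -/
def Rc3 {n d : ℕ} (ν : ProbabilityMeasure (Fin d → ℝ)) (f : Sample n d → ℝ) : ℝ≥0∞ :=
  (n : ℝ≥0∞) * ∑ k₁, ∑ k₂, ∑ k₃, D3 ν (centeredFun ν f) k₁ k₂ k₃

/-- The uniform approximation condition: `f_n` approximates `g_n` in `L_1` on centered bootstrap
samples and on original samples, uniformly over `𝒫_n`. -/
def UniformApprox (d : ℕ → ℕ) (g f : ∀ n, Sample n (d n) → ℝ)
    (P : ∀ n, Set (ProbabilityMeasure (Fin (d n) → ℝ))) : Prop :=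
  Tendsto (fun n => ⨆ ν ∈ P n,
      ((∫⁻ ω, ‖f n (centeredResample (mean ν) ω.1 ω.2.1)
            - g n (centeredResample (mean ν) ω.1 ω.2.1)‖ₑ ∂(jointLaw n ν))
        + ∫⁻ x, ‖f n x - g n x‖ₑ ∂(iidLaw n ν)))
    atTop (𝓝 0)

/-- The uniform smoothness condition: the derivative coefficients vanish uniformly over `𝒫_n`. -/
def UniformSmooth (d : ℕ → ℕ) (f : ∀ n, Sample n (d n) → ℝ)
    (P : ∀ n, Set (ProbabilityMeasure (Fin (d n) → ℝ))) : Prop :=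
  Tendsto (fun n => ⨆ ν ∈ P n, max (Rc1 ν (f n)) (max (Rc2 ν (f n)) (Rc3 ν (f n))))
    atTop (𝓝 0)

/-- The conditional probability, given the data `X = x`, that `g(Z + μ - X̄)` deviates from its
conditional mean by at least `s`. -/
def bootTail {n d : ℕ} (g : Sample n d → ℝ) (μ : Fin d → ℝ) (x : Sample n d) (s : ℝ) : ℝ≥0∞ :=
  indexLaw n {J | |g (centeredResample μ x J)
    - ∫ J', g (centeredResample μ x J') ∂(indexLaw n)| ≥ s}

/-- `P_{X, Y ∼ ν^{⊗ n}}(|g(Y) - E g(Y)| ≥ t(X) + δ)`, with `X` and `Y` independent. -/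
def missProb {n d : ℕ} (ν : ProbabilityMeasure (Fin d → ℝ)) (g t : Sample n d → ℝ) (δ : ℝ) :
    ℝ≥0∞ :=
  ((iidLaw n ν).prod (iidLaw n ν)) {p | |g p.2 - ∫ y, g y ∂(iidLaw n ν)| ≥ t p.1 + δ}

end RobustBootstrap

end

open RobustBootstrap

/-! Freeze the data `x`. After the shift by `mean ν - sampleMean x`, the bootstrap entries are
i.i.d. from the empirical law of the recentered data, whose mean is exactly `mean ν`. The fresh
entries are i.i.d. from `ν` and have the same mean. Lindeberg's method therefore compares,
conditionally on the data, the law of `f` on the recentered bootstrap sample with its law on a fresh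
sample: entries are exchanged one at a time and tested against functions `h` with three bounded
derivatives.

Let L, Q, R be the linear term, the quadratic term and the Taylor remainder of `f` in the exchanged
entry, expanded about `mean ν`. Then `h ∘ f` expands into multiples of L, Q, L² and LQ, up to |R| +
|R|³ + |L|³ + |Q|² + |Q|³. The smoothness condition makes L, Q, R of order o(n^{-1/3}), o(n^{-1/2}),
o(n^{-1}), so this remainder is o(1/n) and survives summation over n steps. The terms Q, L² and LQ
are too large to be bounded in absolute value. Their expectations, however, only differ through the
second and third moments of the true and empirical laws, which agree up to n^{-1/2}, and this extra
factor suffices. The terms in L cancel exactly. Twelve moments are needed because R is a sum of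
products of four factors in L₁₂ and its cube must be integrable.

Two choices of `h` are used. The identity shows that the conditional bootstrap mean of `g` is close
to its true mean. A smoothed indicator of a tail event compares deviation probabilities. Its
derivative bounds depend only on the width of the smoothing, so the centre and the threshold may
depend on the data. The bootstrap guarantee is applied with `μ = mean ν`, and integrating over the
data gives the nominal level plus a constant, depending on δ alone, times the two vanishing
quantities.

The argument is carried by `lindeberg_step`, `lindeberg_conditional`, `lintegral_lindErr_le`,
`exists_conditional_miss_le` and `exists_missProb_le`. -/

namespace RobustBootstrap

/-! ### Independence through resampling of one coordinate. -/

/-- Replacing one coordinate of a product-distributed vector by an independent copy preserves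
the product law. -/
lemma measurePreserving_update {ι X : Type*} [Fintype ι] [DecidableEq ι] [MeasurableSpace X]
    (μ : ι → Measure X) [∀ i, IsProbabilityMeasure (μ i)] (i : ι) :
    MeasurePreserving (fun p : (ι → X) × X => Function.update p.1 i p.2)
      ((Measure.pi μ).prod (μ i)) (Measure.pi μ) := by
  have hm : Measurable (fun p : (ι → X) × X => Function.update p.1 i p.2) := by
    refine measurable_pi_iff.2 fun j => ?_
    by_cases h : j = i
    · subst h; simpa using measurable_snd
    · simp only [Function.update_of_ne h]
      fun_prop
  refine ⟨hm, (Measure.pi_eq fun s hs => ?_).symm⟩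
  rw [Measure.map_apply hm (MeasurableSet.univ_pi hs)]
  -- Boxes suffice. The overwritten coordinate is unconstrained and contributes the factor `μ i univ
  -- = 1`.
  have : (fun p : (ι → X) × X => Function.update p.1 i p.2) ⁻¹' Set.univ.pi s
      = (Set.univ.pi (Function.update s i Set.univ)) ×ˢ s i := by
    ext ⟨y, v⟩
    simp only [Set.mem_preimage, Set.mem_pi, Set.mem_univ, true_implies, Set.mem_prod]
    constructor
    · intro h
      refine ⟨fun j => ?_, by simpa using h i⟩
      by_cases hj : j = i
      · subst hj; simp
      · simpa [Function.update_of_ne hj] using h j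
    · rintro ⟨h1, h2⟩ j
      by_cases hj : j = i
      · subst hj; simpa using h2
      · simpa [Function.update_of_ne hj] using h1 j
  rw [this, Measure.prod_prod, Measure.pi_pi, ← Finset.mul_prod_erase _ _ (Finset.mem_univ i),
    ← Finset.mul_prod_erase _ (fun j => μ j (s j)) (Finset.mem_univ i)]
  simp only [Function.update_self, measure_univ, one_mul]
  rw [mul_comm]
  congr 1
  refine Finset.prod_congr rfl fun j hj => ?_
  rw [Function.update_of_ne (Finset.ne_of_mem_erase hj)]

/-- A random variable that is invariant under resampling is uncorrelated with any function of the
resampled variable. -/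
lemma integral_mul_of_resampling {Ω V : Type*} [MeasurableSpace Ω] [MeasurableSpace V]
    {K : Measure Ω} {κ : Measure V} [SFinite K] [SFinite κ] {S : Ω × V → Ω}
    (hS : MeasurePreserving S (K.prod κ) K) {G ψ : Ω → ℝ} {φ : V → ℝ}
    (hG : Measurable G) (hψ : Measurable ψ)
    (hGS : ∀ p, G (S p) = G p.1) (hψS : ∀ p, ψ (S p) = φ p.2) :
    ∫ ω, G ω * ψ ω ∂K = (∫ ω, G ω ∂K) * ∫ v, φ v ∂κ := by
  -- With `K` written as the image of `K.prod κ` under `S`, `G` sees only the old point and `ψ` only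
  -- the new value, so the integrand is a product.
  rw [← integral_prod_mul]
  conv_lhs => rw [← hS.map_eq]
  rw [integral_map hS.measurable.aemeasurable (f := fun ω => G ω * ψ ω)
    (hG.mul hψ).aestronglyMeasurable]
  simp only [hGS, hψS]

lemma measurePreserving_update_snd {Ω ι X : Type*} [Fintype ι] [DecidableEq ι] [MeasurableSpace X]
    [MeasurableSpace Ω] (Q : Measure Ω) [SFinite Q]
    (μ : ι → Measure X) [∀ i, IsProbabilityMeasure (μ i)] (i : ι) :
    MeasurePreserving (fun p : (Ω × (ι → X)) × X => (p.1.1, Function.update p.1.2 i p.2))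
      ((Q.prod (Measure.pi μ)).prod (μ i)) (Q.prod (Measure.pi μ)) :=
  ((MeasurePreserving.id Q).prod (measurePreserving_update μ i)).comp
    (measurePreserving_prodAssoc Q (Measure.pi μ) (μ i))

lemma measurePreserving_update_fst {Ω ι X : Type*} [Fintype ι] [DecidableEq ι] [MeasurableSpace X]
    [MeasurableSpace Ω] (Q : Measure Ω) [SFinite Q]
    (μ : ι → Measure X) [∀ i, IsProbabilityMeasure (μ i)] (i : ι) :
    MeasurePreserving (fun p : ((ι → X) × Ω) × X => (Function.update p.1.1 i p.2, p.1.2))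
      (((Measure.pi μ).prod Q).prod (μ i)) ((Measure.pi μ).prod Q) :=
  Measure.measurePreserving_swap.comp <| (measurePreserving_update_snd Q μ i).comp <|
    (Measure.measurePreserving_swap (μ := Measure.pi μ) (ν := Q)).prod (MeasurePreserving.id (μ i))

instance {n d : ℕ} (ν : ProbabilityMeasure (Fin d → ℝ)) : IsProbabilityMeasure (iidLaw n ν) :=
  inferInstanceAs (IsProbabilityMeasure (Measure.pi _))

instance {n : ℕ} [NeZero n] : IsProbabilityMeasure (uniformOn (Set.univ : Set (Fin n))) :=
  isProbabilityMeasure_uniformOn Set.finite_univ Set.univ_nonempty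

instance {n : ℕ} [NeZero n] : IsProbabilityMeasure (indexLaw n) :=
  inferInstanceAs (IsProbabilityMeasure (Measure.pi _))

instance {n d : ℕ} [NeZero n] (ν : ProbabilityMeasure (Fin d → ℝ)) :
    IsProbabilityMeasure (jointLaw n ν) :=
  inferInstanceAs (IsProbabilityMeasure (Measure.prod _ _))

lemma uniformOn_univ_fin (n : ℕ) :
    uniformOn (Set.univ : Set (Fin n)) = (n : ℝ≥0∞)⁻¹ • Measure.count := by
  ext s _
  rw [uniformOn_univ]
  simp [div_eq_mul_inv, mul_comm]

lemma integral_uniformOn_fin {n : ℕ} (φ : Fin n → ℝ) :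
    ∫ j, φ j ∂(uniformOn (Set.univ : Set (Fin n))) = (n : ℝ)⁻¹ * ∑ j, φ j := by
  rw [uniformOn_univ_fin, integral_smul_measure, integral_count]
  simp

/-- The law of the resampling indices and of the fresh copy. -/
noncomputable def auxLaw {d : ℕ} (n : ℕ) (ν : ProbabilityMeasure (Fin d → ℝ)) :
    Measure ((Fin n → Fin n) × Sample n d) :=
  (indexLaw n).prod (iidLaw n ν)

instance {n d : ℕ} [NeZero n] (ν : ProbabilityMeasure (Fin d → ℝ)) :
    IsProbabilityMeasure (auxLaw n ν) :=
  inferInstanceAs (IsProbabilityMeasure (Measure.prod _ _))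

/-- `G` depends neither on the `i`-th resampling index nor on the `i`-th fresh vector. -/
def Indep {n d : ℕ} (i : Fin n) (G : (Fin n → Fin n) × Sample n d → ℝ) : Prop :=
  ∀ J y, (∀ a, G (Function.update J i a, y) = G (J, y)) ∧
    ∀ v, G (J, Function.update y i v) = G (J, y)

lemma integral_mul_copy {n d : ℕ} [NeZero n] (ν : ProbabilityMeasure (Fin d → ℝ)) {i : Fin n}
    {G : (Fin n → Fin n) × Sample n d → ℝ} (hG : Measurable G) (hGi : Indep i G)
    {φ : (Fin d → ℝ) → ℝ} (hφ : Measurable φ) :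
    ∫ ω, G ω * φ (ω.2 i) ∂(auxLaw n ν)
      = (∫ ω, G ω ∂(auxLaw n ν)) * ∫ v, φ v ∂(ν : Measure (Fin d → ℝ)) :=
  integral_mul_of_resampling
    (measurePreserving_update_snd (indexLaw n) (fun _ => (ν : Measure (Fin d → ℝ))) i) hG
    (hφ.comp ((measurable_pi_apply i).comp measurable_snd))
    (fun p => (hGi _ _).2 _) (fun p => by simp)

lemma integral_mul_index {n d : ℕ} [NeZero n] (ν : ProbabilityMeasure (Fin d → ℝ)) {i : Fin n}
    {G : (Fin n → Fin n) × Sample n d → ℝ} (hG : Measurable G) (hGi : Indep i G)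
    (φ : Fin n → ℝ) :
    ∫ ω, G ω * φ (ω.1 i) ∂(auxLaw n ν)
      = (∫ ω, G ω ∂(auxLaw n ν)) * ((n : ℝ)⁻¹ * ∑ j, φ j) := by
  rw [← integral_uniformOn_fin]
  exact integral_mul_of_resampling
    (measurePreserving_update_fst (iidLaw n ν)
      (fun _ : Fin n => uniformOn (Set.univ : Set (Fin n))) i) hG
    ((measurable_of_finite φ).comp ((measurable_pi_apply i).comp measurable_fst))
    (fun p => (hGi _ _).1 _) (fun p => by simp)

/-- Replacing a resampled vector by a fresh one in a finite sum of products costs at most the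
mismatch of the corresponding moments. -/
lemma enorm_integral_moment_swap_le {n d : ℕ} [NeZero n] (ν : ProbabilityMeasure (Fin d → ℝ))
    {i : Fin n} {σ : Type*} (s : Finset σ) {G : σ → (Fin n → Fin n) × Sample n d → ℝ}
    (hG : ∀ k, Measurable (G k)) (hGi : ∀ k, Indep i (G k))
    {φ : σ → (Fin d → ℝ) → ℝ} (hφ : ∀ k, Measurable (φ k)) (ψ : σ → Fin n → ℝ)
    (hY : ∀ k ∈ s, Integrable (fun ω => G k ω * φ k (ω.2 i)) (auxLaw n ν))
    (hZ : ∀ k ∈ s, Integrable (fun ω => G k ω * ψ k (ω.1 i)) (auxLaw n ν)) :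
    ‖∫ ω, ((∑ k ∈ s, G k ω * φ k (ω.2 i)) - ∑ k ∈ s, G k ω * ψ k (ω.1 i)) ∂(auxLaw n ν)‖ₑ
      ≤ ∑ k ∈ s, (∫⁻ ω, ‖G k ω‖ₑ ∂(auxLaw n ν)) *
        ‖∫ v, φ k v ∂(ν : Measure (Fin d → ℝ)) - (n : ℝ)⁻¹ * ∑ j, ψ k j‖ₑ := by
  rw [integral_sub (integrable_finsetSum _ hY) (integrable_finsetSum _ hZ),
    integral_finsetSum _ hY, integral_finsetSum _ hZ, ← Finset.sum_sub_distrib]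
  refine (enorm_sum_le _ _).trans (Finset.sum_le_sum fun k hk => ?_)
  rw [integral_mul_copy ν (hG k) (hGi k) (hφ k), integral_mul_index ν (hG k) (hGi k), ← mul_sub,
    enorm_mul]
  gcongr
  exact enorm_integral_le_lintegral_enorm _

end RobustBootstrap

/-! ### Taylor expansion of test functions and of smooth statistics. -/

namespace RobustBootstrap

/-- A second-order Taylor bound on `[0, 1]`. -/
lemma abs_taylor_two_le {φ φ₁ φ₂ φ₃ : ℝ → ℝ} {C : ℝ} (h0 : ∀ r, HasDerivAt φ (φ₁ r) r)
    (h1 : ∀ r, HasDerivAt φ₁ (φ₂ r) r) (h2 : ∀ r, HasDerivAt φ₂ (φ₃ r) r)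
    (hC : ∀ r ∈ Set.Icc (0 : ℝ) 1, |φ₃ r| ≤ C) :
    |φ 1 - φ 0 - φ₁ 0 - φ₂ 0 / 2| ≤ C := by
  have hC0 : 0 ≤ C := (abs_nonneg _).trans (hC 0 (by simp))
  -- The mean value inequality is applied three times, to successive Taylor remainders. On `[0, 1]`
  -- each application preserves the bound `C`; the sharper factor 1/6 is not needed.
  have key : ∀ {ψ ψ' : ℝ → ℝ}, (∀ r, HasDerivAt ψ (ψ' r) r) → ψ 0 = 0 →
      (∀ r ∈ Set.Icc (0 : ℝ) 1, |ψ' r| ≤ C) → ∀ r ∈ Set.Icc (0 : ℝ) 1, |ψ r| ≤ C := by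
    intro ψ ψ' hd hz hb r hr
    have := (convex_Icc (0 : ℝ) 1).norm_image_sub_le_of_norm_hasDerivWithin_le
      (fun x _ => (hd x).hasDerivWithinAt) hb (Set.left_mem_Icc.2 zero_le_one) hr
    rw [hz, sub_zero, sub_zero, Real.norm_eq_abs, Real.norm_eq_abs, abs_of_nonneg hr.1] at this
    exact this.trans (mul_le_of_le_one_right hC0 hr.2)
  have k2 := key (ψ := fun r => φ₂ r - φ₂ 0) (fun r => (h2 r).sub_const _) (by simp) hC
  have k1 := key (ψ := fun r => φ₁ r - φ₁ 0 - r * φ₂ 0) (ψ' := fun r => φ₂ r - φ₂ 0)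
    (fun r => by
      exact (((h1 r).sub_const (φ₁ 0)).sub ((hasDerivAt_id r).mul_const (φ₂ 0))).congr_deriv
        (by simp))
    (by simp) k2
  have k0 := key (ψ := fun r => φ r - φ 0 - r * φ₁ 0 - r ^ 2 / 2 * φ₂ 0)
    (ψ' := fun r => φ₁ r - φ₁ 0 - r * φ₂ 0)
    (fun r => by
      have h := (((h0 r).sub_const (φ 0)).sub ((hasDerivAt_id r).mul_const (φ₁ 0))).sub
        ((((hasDerivAt_id r).pow 2).div_const 2).mul_const (φ₂ 0))
      exact h.congr_deriv (by simp))
    (by simp) k1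
  have := k0 1 (by simp)
  convert this using 2
  ring

/-- A three times differentiable function with first three derivatives bounded by `C`. -/
structure TestFun (h h₁ h₂ h₃ : ℝ → ℝ) (C : ℝ) : Prop where
  d0 : ∀ r, HasDerivAt h (h₁ r) r
  d1 : ∀ r, HasDerivAt h₁ (h₂ r) r
  d2 : ∀ r, HasDerivAt h₂ (h₃ r) r
  b1 : ∀ r, |h₁ r| ≤ C
  b2 : ∀ r, |h₂ r| ≤ C
  b3 : ∀ r, |h₃ r| ≤ C

/-- Only derivatives are required to be bounded, so the identity qualifies; it turns the comparison
of laws into a comparison of expectations. -/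
lemma TestFun.id : TestFun (fun r => r) (fun _ => 1) (fun _ => 0) (fun _ => 0) 1 where
  d0 r := hasDerivAt_id' r
  d1 r := hasDerivAt_const r 1
  d2 r := hasDerivAt_const r 0
  b1 r := by simp
  b2 r := by simp
  b3 r := by simp

lemma TestFun.nonneg {h h₁ h₂ h₃ : ℝ → ℝ} {C : ℝ} (H : TestFun h h₁ h₂ h₃ C) : 0 ≤ C :=
  (abs_nonneg _).trans (H.b1 0)

lemma TestFun.add {h h₁ h₂ h₃ k k₁ k₂ k₃ : ℝ → ℝ} {C D : ℝ} (H : TestFun h h₁ h₂ h₃ C)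
    (K : TestFun k k₁ k₂ k₃ D) :
    TestFun (h + k) (h₁ + k₁) (h₂ + k₂) (h₃ + k₃) (C + D) where
  d0 r := (H.d0 r).add (K.d0 r)
  d1 r := (H.d1 r).add (K.d1 r)
  d2 r := (H.d2 r).add (K.d2 r)
  b1 r := (abs_add_le _ _).trans (add_le_add (H.b1 r) (K.b1 r))
  b2 r := (abs_add_le _ _).trans (add_le_add (H.b2 r) (K.b2 r))
  b3 r := (abs_add_le _ _).trans (add_le_add (H.b3 r) (K.b3 r))

/-- The factor `(1 + |a|) ^ 3` dominates `|a|`, `|a| ^ 2` and `|a| ^ 3` at once. The bound is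
independent of the translation `b`, which is what later permits data-dependent centres and
thresholds. -/
lemma TestFun.comp_affine {h h₁ h₂ h₃ : ℝ → ℝ} {C : ℝ} (H : TestFun h h₁ h₂ h₃ C) (a b : ℝ) :
    TestFun (fun r => h (a * r + b)) (fun r => a * h₁ (a * r + b))
      (fun r => a ^ 2 * h₂ (a * r + b)) (fun r => a ^ 3 * h₃ (a * r + b))
      (C * (1 + |a|) ^ 3) := by
  have hl : ∀ r, HasDerivAt (fun r => a * r + b) a r := fun r => by
    simpa using ((hasDerivAt_id r).const_mul a).add_const b
  have ha := abs_nonneg a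
  have hC := H.nonneg
  refine ⟨fun r => ?_, fun r => ?_, fun r => ?_, fun r => ?_, fun r => ?_, fun r => ?_⟩
  · have := (H.d0 (a * r + b)).comp r (hl r)
    rwa [mul_comm] at this
  · have := ((H.d1 (a * r + b)).comp r (hl r)).const_mul a
    exact this.congr_deriv (by ring)
  · have := ((H.d2 (a * r + b)).comp r (hl r)).const_mul (a ^ 2)
    exact this.congr_deriv (by ring)
  · rw [abs_mul, mul_comm]
    exact mul_le_mul (H.b1 _) (by nlinarith [pow_nonneg ha 2, pow_nonneg ha 3]) ha hC
  · rw [abs_mul, mul_comm, abs_pow]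
    exact mul_le_mul (H.b2 _) (by nlinarith [pow_nonneg ha 2, pow_nonneg ha 3]) (by positivity) hC
  · rw [abs_mul, mul_comm, abs_pow]
    exact mul_le_mul (H.b3 _) (by nlinarith [pow_nonneg ha 2, pow_nonneg ha 3]) (by positivity) hC

lemma TestFun.abs_taylor_le {h h₁ h₂ h₃ : ℝ → ℝ} {C : ℝ} (H : TestFun h h₁ h₂ h₃ C) (b a : ℝ) :
    |h (b + a) - h b - h₁ b * a - h₂ b * a ^ 2 / 2| ≤ C * |a| ^ 3 := by
  have hl : ∀ r, HasDerivAt (fun r => b + r * a) a r := fun r => by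
    simpa using ((hasDerivAt_id r).mul_const a).const_add b
  have := abs_taylor_two_le (φ := fun r => h (b + r * a)) (φ₁ := fun r => h₁ (b + r * a) * a)
    (φ₂ := fun r => h₂ (b + r * a) * a * a) (φ₃ := fun r => h₃ (b + r * a) * a * a * a)
    (C := C * |a| ^ 3)
    (fun r => (H.d0 _).comp r (hl r)) (fun r => ((H.d1 _).comp r (hl r)).mul_const a)
    (fun r => (((H.d2 _).comp r (hl r)).mul_const a).mul_const a)
    (fun r _ => by
      rw [mul_assoc, mul_assoc, abs_mul, show |a * (a * a)| = |a| ^ 3 by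
        rw [← abs_pow]; congr 1; ring]
      gcongr
      exact H.b3 _)
  convert this using 2
  simp
  ring

/-- Expansion of a test function along a perturbation made of a linear term `L`, half a quadratic
term `Q` and a remainder `R`. -/
lemma TestFun.abs_expansion_le {h h₁ h₂ h₃ : ℝ → ℝ} {C : ℝ} (H : TestFun h h₁ h₂ h₃ C)
    (b L Q R : ℝ) :
    |h (b + (L + Q / 2 + R)) - h b
        - (h₁ b * L + (h₁ b * Q + h₂ b * L ^ 2) / 2 + h₂ b * (L * Q) / 2)|
      ≤ 20 * C * (|R| + |R| ^ 3 + |L| ^ 3 + |Q| ^ 2 + |Q| ^ 3) := by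
  have hC := H.nonneg
  have hT := H.abs_taylor_le b (L + Q / 2 + R)
  set a := L + Q / 2 + R with ha
  have hL := abs_nonneg L
  have hQ := abs_nonneg Q
  have hR := abs_nonneg R
  have ha3 : |a| ^ 3 ≤ 9 * (|L| ^ 3 + |Q| ^ 3 + |R| ^ 3) := by
    have : |a| ≤ |L| + |Q| + |R| := by
      calc |a| ≤ |L| + |Q / 2| + |R| := abs_add_three _ _ _
        _ ≤ _ := by rw [abs_div]; norm_num
    calc |a| ^ 3 ≤ (|L| + |Q| + |R|) ^ 3 := by gcongr
      _ ≤ _ := by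
        nlinarith [mul_nonneg (add_nonneg hL hQ) (sq_nonneg (|L| - |Q|)),
          mul_nonneg (add_nonneg hL hR) (sq_nonneg (|L| - |R|)),
          mul_nonneg (add_nonneg hR hQ) (sq_nonneg (|R| - |Q|)),
          mul_nonneg hL (sq_nonneg (|Q| - |R|)), mul_nonneg hQ (sq_nonneg (|L| - |R|)),
          mul_nonneg hR (sq_nonneg (|L| - |Q|))]
  have hR2 : |R| ^ 2 ≤ |R| + |R| ^ 3 := by nlinarith [mul_nonneg hR (sq_nonneg (|R| - 1))]
  -- `L` alone has no small second power available, so the mixed term is absorbed by cases: into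
  -- `|R|` if `|L| ≤ 1`, otherwise into the cube of the larger factor.
  have hLR : |L| * |R| ≤ |L| ^ 3 + |R| ^ 3 + |R| := by
    rcases le_total |L| 1 with h1 | h1
    · nlinarith [pow_nonneg hL 3, pow_nonneg hR 3]
    · rcases le_total |L| |R| with h2 | h2
      · have : |L| * |R| ≤ |R| ^ 3 := by
          calc |L| * |R| ≤ |R| * |R| := by gcongr
            _ ≤ |R| * |R| * |R| := le_mul_of_one_le_right (by positivity) (h1.trans h2)
            _ = _ := by ring
        nlinarith [pow_nonneg hL 3]
      · have : |L| * |R| ≤ |L| ^ 3 := by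
          calc |L| * |R| ≤ |L| * |L| := by gcongr
            _ ≤ |L| * |L| * |L| := le_mul_of_one_le_right (by positivity) h1
            _ = _ := by ring
        nlinarith [pow_nonneg hR 3]
  have hQR : |Q| * |R| ≤ |Q| ^ 2 + |R| ^ 2 := by nlinarith [sq_nonneg (|Q| - |R|), sq_nonneg |Q|]
  -- The monomials L, Q, L² and LQ are retained for moment matching; all the others go into the
  -- error. Adding the estimates gives coefficients at most 12, so 20 is generous.
  have e : h (b + a) - h b - (h₁ b * L + (h₁ b * Q + h₂ b * L ^ 2) / 2 + h₂ b * (L * Q) / 2)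
      = (h (b + a) - h b - h₁ b * a - h₂ b * a ^ 2 / 2) + h₁ b * R
        + h₂ b * ((Q ^ 2 / 4 + R ^ 2 + 2 * (L * R) + Q * R) / 2) := by
    rw [ha]; ring
  have hX : |(Q ^ 2 / 4 + R ^ 2 + 2 * (L * R) + Q * R) / 2|
      ≤ |Q| ^ 2 + |R| ^ 2 + |L| * |R| + |Q| * |R| := by
    rw [← abs_mul L R, ← abs_mul Q R, sq_abs, sq_abs]
    have h1 := abs_le.1 (le_refl |L * R|)
    have h2 := abs_le.1 (le_refl |Q * R|)
    rw [abs_le]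
    constructor <;> nlinarith [sq_nonneg Q, sq_nonneg R, abs_nonneg (Q * R)]
  rw [e]
  refine (abs_add_three _ _ _).trans ?_
  rw [abs_mul, abs_mul]
  have t1 : C * |a| ^ 3 ≤ C * (9 * (|L| ^ 3 + |Q| ^ 3 + |R| ^ 3)) := by gcongr
  have t2 : |h₁ b| * |R| ≤ C * |R| := by gcongr; exact H.b1 b
  have t3 : |h₂ b| * |(Q ^ 2 / 4 + R ^ 2 + 2 * (L * R) + Q * R) / 2|
      ≤ C * (|Q| ^ 2 + |R| ^ 2 + |L| * |R| + |Q| * |R|) :=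
    mul_le_mul (H.b2 b) hX (abs_nonneg _) hC
  refine (add_le_add (add_le_add (hT.trans t1) t2) t3).trans ?_
  rw [← mul_add, ← mul_add, mul_comm 20 C, mul_assoc]
  refine mul_le_mul_of_nonneg_left ?_ hC
  nlinarith [pow_nonneg hL 3, pow_nonneg hR 3, pow_nonneg hQ 3, pow_nonneg hQ 2]

/-- The sample whose `i`-th entry is `u`, the others being zero. -/
abbrev atIndex {n d : ℕ} (i : Fin n) (u : Fin d → ℝ) : Sample n d := Pi.single i u

lemma contDiff_partialD {n d : ℕ} {m : ℕ} {F : Sample n d → ℝ} (hF : ContDiff ℝ (m + 1 : ℕ) F)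
    (i : Fin n) (k : Fin d) : ContDiff ℝ m (partialD i k F) := by
  refine ContDiff.clm_apply (hF.fderiv_right (m := m) ?_) contDiff_const
  norm_cast

lemma hasDerivAt_partialD {n d : ℕ} {F : Sample n d → ℝ} (hF : Differentiable ℝ F) (i : Fin n)
    (p : Sample n d) (u : Fin d → ℝ) (r : ℝ) :
    HasDerivAt (fun r : ℝ => F (p + r • atIndex i u))
      (∑ k, u k * partialD i k F (p + r • atIndex i u)) r := by
  have hl : HasDerivAt (fun r : ℝ => p + r • atIndex i u) (atIndex i u) r := by
    simpa using ((hasDerivAt_id r).smul_const (atIndex i u)).const_add p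
  refine ((hF _).hasFDerivAt.comp_hasDerivAt r hl).congr_deriv ?_
  have : atIndex i u = ∑ k, u k • Pi.single i (Pi.single k 1) := by
    ext j l
    rw [atIndex]
    by_cases hj : j = i
    · subst hj
      simp [Finset.sum_apply, Pi.single_apply]
    · simp [Finset.sum_apply, Pi.single_eq_of_ne hj]
  rw [this, map_sum]
  simp [partialD]

/-- Taylor expansion of a smooth function of a sample in its `i`-th argument. -/
lemma enorm_taylor_partialD_le {n d : ℕ} {f : Sample n d → ℝ} (hf : ContDiff ℝ 3 f) (i : Fin n)
    (p : Sample n d) (u : Fin d → ℝ) :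
    ‖f (p + atIndex i u) - f p - ∑ k, u k * partialD i k f p
        - (∑ k₂, ∑ k₁, u k₂ * (u k₁ * partialD i k₁ (partialD i k₂ f) p)) / 2‖ₑ
      ≤ ∑ k₃, ∑ k₂, ∑ k₁, ‖u k₃‖ₑ * ‖u k₂‖ₑ * ‖u k₁‖ₑ * ⨆ r ∈ Set.Icc (0 : ℝ) 1,
        ‖partialD i k₁ (partialD i k₂ (partialD i k₃ f)) (p + r • atIndex i u)‖ₑ := by
  set T : Fin d → Fin d → Fin d → ℝ≥0∞ := fun k₃ k₂ k₁ => ⨆ r ∈ Set.Icc (0 : ℝ) 1,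
        ‖partialD i k₁ (partialD i k₂ (partialD i k₃ f)) (p + r • atIndex i u)‖ₑ with hT
  -- The bound lives in `[0, ∞]`. If it is infinite nothing is to be shown; otherwise it converts to
  -- a real constant.
  by_cases htop : (∑ k₃, ∑ k₂, ∑ k₁, ‖u k₃‖ₑ * ‖u k₂‖ₑ * ‖u k₁‖ₑ * T k₃ k₂ k₁) = ⊤
  · rw [htop]; exact le_top
  have hf1 : ∀ k, ContDiff ℝ 2 (partialD i k f) := fun k => contDiff_partialD (m := 2) hf i k
  have hf2 : ∀ k k', ContDiff ℝ 1 (partialD i k (partialD i k' f)) :=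
    fun k k' => contDiff_partialD (m := 1) (hf1 k') i k
  have key := abs_taylor_two_le (φ := fun r => f (p + r • atIndex i u))
    (C := (∑ k₃, ∑ k₂, ∑ k₁, ‖u k₃‖ₑ * ‖u k₂‖ₑ * ‖u k₁‖ₑ * T k₃ k₂ k₁).toReal)
    (fun r => hasDerivAt_partialD (hf.differentiable (by norm_num)) i p u r)
    (fun r => HasDerivAt.fun_sum fun k₂ _ =>
      (hasDerivAt_partialD ((hf1 k₂).differentiable (by norm_num)) i p u r).const_mul (u k₂))
    (fun r => HasDerivAt.fun_sum fun k₂ _ => (HasDerivAt.fun_sum fun k₁ _ =>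
      (hasDerivAt_partialD ((hf2 k₁ k₂).differentiable (by norm_num)) i p u r).const_mul
        (u k₁)).const_mul (u k₂))
    (fun r hr => by
      rw [← Real.norm_eq_abs, ← toReal_enorm]
      refine ENNReal.toReal_mono htop ?_
      refine (enorm_sum_le _ _).trans (Finset.sum_le_sum fun k₃ _ => ?_)
      rw [enorm_mul]
      simp only [mul_assoc]
      simp only [← Finset.mul_sum]
      gcongr
      refine (enorm_sum_le _ _).trans (Finset.sum_le_sum fun k₂ _ => ?_)
      rw [enorm_mul]
      gcongr
      refine (enorm_sum_le _ _).trans (Finset.sum_le_sum fun k₁ _ => ?_)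
      rw [enorm_mul]
      gcongr
      rw [hT]
      exact le_iSup₂ (f := fun r (_ : r ∈ Set.Icc (0 : ℝ) 1) =>
        ‖partialD i k₁ (partialD i k₂ (partialD i k₃ f)) (p + r • atIndex i u)‖ₑ) r hr)
  rw [← ENNReal.ofReal_toReal htop, Real.enorm_eq_ofReal_abs]
  refine ENNReal.ofReal_le_ofReal ?_
  simpa [Finset.mul_sum] using key

end RobustBootstrap

/-! ### One exchange step of Lindeberg's method. -/

namespace RobustBootstrap

section Forms

variable {d : ℕ}

/-- The linear form with coefficients `c`. -/
def lin (c u : Fin d → ℝ) : ℝ := ∑ k, u k * c k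

/-- The quadratic form with coefficients `c`. -/
def quad (c : Fin d × Fin d → ℝ) (u : Fin d → ℝ) : ℝ := ∑ p, u p.1 * (u p.2 * c p)

/-- The sum of the absolute values of the terms of `lin c u`. -/
noncomputable def linAbs (c u : Fin d → ℝ) : ℝ≥0∞ := ∑ k, ‖u k‖ₑ * ‖c k‖ₑ

/-- The sum of the absolute values of the terms of `quad c u`. -/
noncomputable def quadAbs (c : Fin d × Fin d → ℝ) (u : Fin d → ℝ) : ℝ≥0∞ :=
  ∑ p, ‖u p.1‖ₑ * ‖u p.2‖ₑ * ‖c p‖ₑ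

/-- The size of the remainder in the expansion of a test function, in terms of bounds for the
linear term, the quadratic term and the Taylor remainder. -/
noncomputable def remAbs (a b r : ℝ≥0∞) : ℝ≥0∞ := r + r ^ 3 + a ^ 3 + b ^ 2 + b ^ 3

lemma enorm_lin_le (c u : Fin d → ℝ) : ‖lin c u‖ₑ ≤ linAbs c u :=
  (enorm_sum_le _ _).trans_eq (by simp [linAbs, enorm_mul])

lemma enorm_quad_le (c : Fin d × Fin d → ℝ) (u : Fin d → ℝ) : ‖quad c u‖ₑ ≤ quadAbs c u :=
  (enorm_sum_le _ _).trans_eq (by simp [quadAbs, enorm_mul, mul_assoc])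

lemma remAbs_mono {a b r a' b' r' : ℝ≥0∞} (ha : a ≤ a') (hb : b ≤ b') (hr : r ≤ r') :
    remAbs a b r ≤ remAbs a' b' r' := by
  unfold remAbs; gcongr

lemma le_one_add_pow (a : ℝ≥0∞) {k l : ℕ} (h : k ≤ l) : a ^ k ≤ 1 + a ^ l := by
  rcases le_total a 1 with h1 | h1
  · exact (pow_le_one' h1 k).trans le_self_add
  · exact (pow_le_pow_right₀ h1 h).trans le_add_self

/-- This and the next two bounds dominate each retained monomial by a constant plus the remainder.
On a probability space, finiteness of the integrated remainder then makes every monomial integrable,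
so no integrability has to be assumed. -/
lemma linAbs_le (a b r : ℝ≥0∞) : a ≤ 2 * (1 + remAbs a b r) := by
  have := le_one_add_pow a (k := 1) (l := 3) (by norm_num)
  rw [pow_one] at this
  refine this.trans (le_trans ?_ (le_mul_of_one_le_left zero_le one_le_two))
  gcongr
  exact le_add_right (le_add_right le_add_self)

lemma quadAbs_add_le (a b r : ℝ≥0∞) : b + a * a ≤ 2 * (1 + remAbs a b r) := by
  have h1 := le_one_add_pow b (k := 1) (l := 2) (by norm_num)
  have h2 := le_one_add_pow a (k := 2) (l := 3) (by norm_num)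
  rw [pow_one] at h1
  rw [two_mul, ← pow_two]
  refine add_le_add (h1.trans ?_) (h2.trans ?_) <;> gcongr
  · exact le_add_right le_add_self
  · exact le_add_right (le_add_right le_add_self)

lemma mul_quadAbs_le (a b r : ℝ≥0∞) : a * b ≤ 2 * (1 + remAbs a b r) := by
  have h2 := le_one_add_pow a (k := 2) (l := 3) (by norm_num)
  have : a * b ≤ a ^ 2 + b ^ 2 := by
    rcases le_total a b with h | h
    · exact (mul_le_mul_left h b).trans (by rw [← pow_two]; exact le_add_self)
    · exact (mul_le_mul_right h a).trans (by rw [← pow_two]; exact le_self_add)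
  refine this.trans ((add_le_add h2 le_rfl).trans
    (le_trans ?_ (le_mul_of_one_le_left zero_le one_le_two)))
  rw [add_assoc]
  gcongr
  exact le_add_right (add_le_add le_add_self le_rfl)

lemma TestFun.enorm_expansion_le {h h₁ h₂ h₃ : ℝ → ℝ} {C : ℝ} (H : TestFun h h₁ h₂ h₃ C)
    (b L Q R : ℝ) :
    ‖h (b + (L + Q / 2 + R)) - h b
        - (h₁ b * L + (h₁ b * Q + h₂ b * L ^ 2) / 2 + h₂ b * (L * Q) / 2)‖ₑ
      ≤ ENNReal.ofReal (20 * C) * remAbs ‖L‖ₑ ‖Q‖ₑ ‖R‖ₑ := by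
  have hC := H.nonneg
  rw [Real.enorm_eq_ofReal_abs]
  refine (ENNReal.ofReal_le_ofReal (H.abs_expansion_le b L Q R)).trans_eq ?_
  rw [ENNReal.ofReal_mul (by positivity)]
  congr 1
  rw [ENNReal.ofReal_add (by positivity) (by positivity),
    ENNReal.ofReal_add (by positivity) (by positivity),
    ENNReal.ofReal_add (by positivity) (by positivity),
    ENNReal.ofReal_add (by positivity) (by positivity)]
  simp only [ENNReal.ofReal_pow (abs_nonneg _), ← Real.enorm_eq_ofReal_abs, remAbs]

/-- Each monomial is split into a coefficient, which will not involve the exchanged entry, times a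
product of coordinates of `u`. This is the form to which independence applies. -/
lemma expansion_eq_sums (s t : ℝ) (c₁ : Fin d → ℝ) (c₂ : Fin d × Fin d → ℝ) (u : Fin d → ℝ) :
    s * lin c₁ u + (s * quad c₂ u + t * lin c₁ u ^ 2) / 2 + t * (lin c₁ u * quad c₂ u) / 2
      = ∑ k, s * c₁ k * u k
        + ∑ p : Fin d × Fin d, (s * c₂ p + t * (c₁ p.1 * c₁ p.2)) / 2 * (u p.1 * u p.2)
        + ∑ q : Fin d × Fin d × Fin d, t * (c₁ q.1 * c₂ q.2) / 2 * (u q.1 * (u q.2.1 * u q.2.2)) := by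
  congr 1
  · congr 1
    · rw [lin, Finset.mul_sum]
      exact Finset.sum_congr rfl fun k _ => by ring
    · rw [pow_two, lin, Finset.sum_mul_sum, ← Finset.sum_product', quad, Finset.univ_product_univ,
        Finset.mul_sum, Finset.mul_sum, ← Finset.sum_add_distrib, Finset.sum_div]
      exact Finset.sum_congr rfl fun k _ => by ring
  · rw [lin, quad, Finset.sum_mul_sum, ← Finset.sum_product', Finset.univ_product_univ,
      Finset.mul_sum, Finset.sum_div]
    exact Finset.sum_congr rfl fun k _ => by ring

end Forms

section Step

variable {n d : ℕ}

/-- The difference of the second moments of a centered vector and of an empirical law. -/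
noncomputable def momentGap₂ (ν : ProbabilityMeasure (Fin d → ℝ)) (ζ : Sample n d)
    (p : Fin d × Fin d) : ℝ :=
  ∫ v, (v p.1 - mean ν p.1) * (v p.2 - mean ν p.2) ∂(ν : Measure (Fin d → ℝ))
    - (n : ℝ)⁻¹ * ∑ j, ζ j p.1 * ζ j p.2

/-- The difference of the third moments of a centered vector and of an empirical law. -/
noncomputable def momentGap₃ (ν : ProbabilityMeasure (Fin d → ℝ)) (ζ : Sample n d)
    (q : Fin d × Fin d × Fin d) : ℝ :=
  ∫ v, (v q.1 - mean ν q.1) * ((v q.2.1 - mean ν q.2.1) * (v q.2.2 - mean ν q.2.2))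
      ∂(ν : Measure (Fin d → ℝ))
    - (n : ℝ)⁻¹ * ∑ j, ζ j q.1 * (ζ j q.2.1 * ζ j q.2.2)

/-- The total bound for one Lindeberg exchange step. -/
noncomputable def stepBound (δ₂ : Fin d × Fin d → ℝ) (δ₃ : Fin d × Fin d × Fin d → ℝ)
    (c₁ : Fin d → ℝ) (c₂ : Fin d × Fin d → ℝ) (u w : Fin d → ℝ) (r s : ℝ≥0∞) : ℝ≥0∞ :=
  ((∑ p, (‖c₂ p‖ₑ + ‖c₁ p.1‖ₑ * ‖c₁ p.2‖ₑ) * ‖δ₂ p‖ₑ)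
    + ∑ q : Fin d × Fin d × Fin d, ‖c₁ q.1‖ₑ * ‖c₂ q.2‖ₑ * ‖δ₃ q‖ₑ)
  + (remAbs (linAbs c₁ u) (quadAbs c₂ u) r + remAbs (linAbs c₁ w) (quadAbs c₂ w) s)

lemma Indep.comp₂ {i : Fin n} {G H : (Fin n → Fin n) × Sample n d → ℝ} (hG : Indep i G)
    (hH : Indep i H) (φ : ℝ → ℝ → ℝ) : Indep i fun ω => φ (G ω) (H ω) := fun J y =>
  ⟨fun a => by simp only [(hG J y).1, (hH J y).1], fun v => by simp only [(hG J y).2, (hH J y).2]⟩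

lemma measurable_remAbs {Ω : Type*} [MeasurableSpace Ω] {a b r : Ω → ℝ≥0∞} (ha : Measurable a)
    (hb : Measurable b) (hr : Measurable r) : Measurable fun ω => remAbs (a ω) (b ω) (r ω) := by
  unfold remAbs; fun_prop

lemma measurable_linAbs {Ω : Type*} [MeasurableSpace Ω] {c u : Ω → Fin d → ℝ} (hc : Measurable c)
    (hu : Measurable u) : Measurable fun ω => linAbs (c ω) (u ω) := by
  unfold linAbs; fun_prop

lemma measurable_quadAbs {Ω : Type*} [MeasurableSpace Ω] {c : Ω → Fin d × Fin d → ℝ}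
    {u : Ω → Fin d → ℝ} (hc : Measurable c)
    (hu : Measurable u) : Measurable fun ω => quadAbs (c ω) (u ω) := by
  unfold quadAbs; fun_prop

/-- One exchange step of Lindeberg's method, with matching first moments. -/
lemma lindeberg_step [NeZero n] (ν : ProbabilityMeasure (Fin d → ℝ))
    (hν : Integrable (fun v => v) (ν : Measure (Fin d → ℝ)))
    {ζ : Sample n d} (hζ : ∀ k, ∑ j, ζ j k = 0) (i : Fin n)
    {F₀ fY fZ : (Fin n → Fin n) × Sample n d → ℝ}
    {c₁ : (Fin n → Fin n) × Sample n d → Fin d → ℝ}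
    {c₂ : (Fin n → Fin n) × Sample n d → Fin d × Fin d → ℝ}
    {rY rZ : (Fin n → Fin n) × Sample n d → ℝ≥0∞}
    (hF₀ : Measurable F₀) (hfY : Measurable fY) (hfZ : Measurable fZ) (hc₁ : Measurable c₁)
    (hc₂ : Measurable c₂) (hrY : Measurable rY) (hrZ : Measurable rZ)
    (iF₀ : Indep i F₀) (ic₁ : ∀ k, Indep i fun ω => c₁ ω k) (ic₂ : ∀ p, Indep i fun ω => c₂ ω p)
    (bY : ∀ ω, ‖fY ω - F₀ ω - lin (c₁ ω) (ω.2 i - mean ν)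
      - quad (c₂ ω) (ω.2 i - mean ν) / 2‖ₑ ≤ rY ω)
    (bZ : ∀ ω, ‖fZ ω - F₀ ω - lin (c₁ ω) (ζ (ω.1 i))
      - quad (c₂ ω) (ζ (ω.1 i)) / 2‖ₑ ≤ rZ ω)
    (hfin : ∫⁻ ω, stepBound (momentGap₂ ν ζ) (momentGap₃ ν ζ) (c₁ ω) (c₂ ω) (ω.2 i - mean ν)
      (ζ (ω.1 i)) (rY ω) (rZ ω) ∂(auxLaw n ν) ≠ ⊤)
    {h h₁ h₂ h₃ : ℝ → ℝ} {C : ℝ} (H : TestFun h h₁ h₂ h₃ C) :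
    Integrable (fun ω => h (fY ω) - h (fZ ω)) (auxLaw n ν) ∧
    ‖∫ ω, (h (fY ω) - h (fZ ω)) ∂(auxLaw n ν)‖ₑ ≤ ENNReal.ofReal (20 * C) *
      ∫⁻ ω, stepBound (momentGap₂ ν ζ) (momentGap₃ ν ζ) (c₁ ω) (c₂ ω) (ω.2 i - mean ν)
      (ζ (ω.1 i)) (rY ω) (rZ ω) ∂(auxLaw n ν) := by
  have hC := H.nonneg
  set K := auxLaw n ν with hK
  set uY : (Fin n → Fin n) × Sample n d → Fin d → ℝ := fun ω => ω.2 i - mean ν with huY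
  set uZ : (Fin n → Fin n) × Sample n d → Fin d → ℝ := fun ω => ζ (ω.1 i) with huZ
  have muY : Measurable uY := by fun_prop
  have muZ : Measurable uZ := (measurable_of_finite ζ).comp (by fun_prop)
  have mh : Measurable h := (Differentiable.continuous fun r => (H.d0 r).differentiableAt).measurable
  have mh₁ : Measurable h₁ :=
    (Differentiable.continuous fun r => (H.d1 r).differentiableAt).measurable
  have mh₂ : Measurable h₂ :=
    (Differentiable.continuous fun r => (H.d2 r).differentiableAt).measurable
  set remY : (Fin n → Fin n) × Sample n d → ℝ≥0∞ := fun ω =>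
    remAbs (linAbs (c₁ ω) (uY ω)) (quadAbs (c₂ ω) (uY ω)) (rY ω) with hremY
  set remZ : (Fin n → Fin n) × Sample n d → ℝ≥0∞ := fun ω =>
    remAbs (linAbs (c₁ ω) (uZ ω)) (quadAbs (c₂ ω) (uZ ω)) (rZ ω) with hremZ
  have mremY : Measurable remY :=
    measurable_remAbs (measurable_linAbs hc₁ muY) (measurable_quadAbs hc₂ muY) hrY
  have mremZ : Measurable remZ :=
    measurable_remAbs (measurable_linAbs hc₁ muZ) (measurable_quadAbs hc₂ muZ) hrZ
  set G₁ : Fin d → (Fin n → Fin n) × Sample n d → ℝ := fun k ω => h₁ (F₀ ω) * c₁ ω k with hG₁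
  set G₂ : Fin d × Fin d → (Fin n → Fin n) × Sample n d → ℝ := fun p ω =>
    (h₁ (F₀ ω) * c₂ ω p + h₂ (F₀ ω) * (c₁ ω p.1 * c₁ ω p.2)) / 2 with hG₂
  set G₃ : Fin d × Fin d × Fin d → (Fin n → Fin n) × Sample n d → ℝ := fun q ω =>
    h₂ (F₀ ω) * (c₁ ω q.1 * c₂ ω q.2) / 2 with hG₃
  have mG₁ : ∀ k, Measurable (G₁ k) := fun k => by fun_prop
  have mG₂ : ∀ k, Measurable (G₂ k) := fun k => by fun_prop
  have mG₃ : ∀ k, Measurable (G₃ k) := fun k => by fun_prop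
  have iG₁ : ∀ k, Indep i (G₁ k) := fun k => iF₀.comp₂ (ic₁ k) fun a b => h₁ a * b
  have iG₂ : ∀ k, Indep i (G₂ k) := fun p => by
    have e1 := iF₀.comp₂ (ic₂ p) fun a b => h₁ a * b
    have e2 := iF₀.comp₂ ((ic₁ p.1).comp₂ (ic₁ p.2) fun a b => a * b) fun a b => h₂ a * b
    exact e1.comp₂ e2 fun a b => (a + b) / 2
  have iG₃ : ∀ k, Indep i (G₃ k) := fun q =>
    iF₀.comp₂ ((ic₁ q.1).comp₂ (ic₂ q.2) fun a b => a * b) fun a b => h₂ a * b / 2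
  have eh₁ : ∀ r, ‖h₁ r‖ₑ ≤ ENNReal.ofReal C := fun r => by
    rw [Real.enorm_eq_ofReal_abs]; exact ENNReal.ofReal_le_ofReal (H.b1 r)
  have eh₂ : ∀ r, ‖h₂ r‖ₑ ≤ ENNReal.ofReal C := fun r => by
    rw [Real.enorm_eq_ofReal_abs]; exact ENNReal.ofReal_le_ofReal (H.b2 r)
  have half : ∀ a : ℝ, ‖a / 2‖ₑ ≤ ‖a‖ₑ := fun a => by
    rw [Real.enorm_eq_ofReal_abs, Real.enorm_eq_ofReal_abs, abs_div]
    refine ENNReal.ofReal_le_ofReal (div_le_self (abs_nonneg a) (by norm_num))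
  have bG₁ : ∀ k ω, ‖G₁ k ω‖ₑ ≤ ENNReal.ofReal C * ‖c₁ ω k‖ₑ := fun k ω => by
    rw [enorm_mul]; gcongr; exact eh₁ _
  have bG₂ : ∀ p ω, ‖G₂ p ω‖ₑ
      ≤ ENNReal.ofReal C * (‖c₂ ω p‖ₑ + ‖c₁ ω p.1‖ₑ * ‖c₁ ω p.2‖ₑ) := fun p ω => by
    refine (half _).trans ((enorm_add_le _ _).trans ?_)
    rw [enorm_mul, enorm_mul, enorm_mul, mul_add]
    gcongr
    exacts [eh₁ _, eh₂ _]
  have bG₃ : ∀ q ω, ‖G₃ q ω‖ₑ ≤ ENNReal.ofReal C * (‖c₁ ω q.1‖ₑ * ‖c₂ ω q.2‖ₑ) := fun q ω => by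
    refine (half _).trans ?_
    rw [enorm_mul, enorm_mul]
    gcongr
    exact eh₂ _
  -- the moment-mismatch terms and the remainders are integrable
  have hsplit : ∫⁻ ω, stepBound (momentGap₂ ν ζ) (momentGap₃ ν ζ) (c₁ ω) (c₂ ω) (uY ω) (uZ ω)
      (rY ω) (rZ ω) ∂K
      = ((∑ p, (∫⁻ ω, (‖c₂ ω p‖ₑ + ‖c₁ ω p.1‖ₑ * ‖c₁ ω p.2‖ₑ) ∂K) * ‖momentGap₂ ν ζ p‖ₑ)
        + ∑ q : Fin d × Fin d × Fin d,
            (∫⁻ ω, ‖c₁ ω q.1‖ₑ * ‖c₂ ω q.2‖ₑ ∂K) * ‖momentGap₃ ν ζ q‖ₑ)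
        + ((∫⁻ ω, remY ω ∂K) + ∫⁻ ω, remZ ω ∂K) := by
    unfold stepBound
    rw [lintegral_add_right _ (show Measurable fun ω => remY ω + remZ ω from mremY.add mremZ),
      lintegral_add_left mremY,
      lintegral_add_left (by fun_prop), lintegral_finsetSum _ (fun p _ => by fun_prop),
      lintegral_finsetSum _ (fun p _ => by fun_prop)]
    congr 2
    · exact Finset.sum_congr rfl fun p _ => lintegral_mul_const _ (by fun_prop)
    · exact Finset.sum_congr rfl fun p _ => lintegral_mul_const _ (by fun_prop)
  rw [hsplit] at hfin ⊢
  have finY : ∫⁻ ω, remY ω ∂K ≠ ⊤ := fun ht => hfin (by simp [ht])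
  have finZ : ∫⁻ ω, remZ ω ∂K ≠ ⊤ := fun ht => hfin (by simp [ht])
  -- Shared integrability criterion: domination by `1 + ρ`, where `ρ` is one of the two remainder
  -- sizes.
  have dom : ∀ {ρ : (Fin n → Fin n) × Sample n d → ℝ≥0∞}, Measurable ρ → ∫⁻ ω, ρ ω ∂K ≠ ⊤ →
      ∀ {T : (Fin n → Fin n) × Sample n d → ℝ}, Measurable T →
      (∀ ω, ‖T ω‖ₑ ≤ ENNReal.ofReal C * (2 * (1 + ρ ω))) → Integrable T K := by
    intro ρ mρ fρ T mT bT
    refine ⟨mT.aestronglyMeasurable, lt_of_le_of_lt (lintegral_mono bT) ?_⟩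
    rw [lintegral_const_mul _ (by fun_prop), lintegral_const_mul _ (by fun_prop),
      lintegral_add_left (by fun_prop)]
    simp only [lintegral_const, measure_univ, mul_one]
    exact ENNReal.mul_lt_top ENNReal.ofReal_lt_top
      (ENNReal.mul_lt_top (by simp) (ENNReal.add_lt_top.2 ⟨by simp, fρ.lt_top⟩))
  have term₁ : ∀ {c u : Fin d → ℝ} (k : Fin d), ‖c k‖ₑ * ‖u k‖ₑ ≤ linAbs c u := fun {c u} k => by
    rw [mul_comm]
    exact Finset.single_le_sum (f := fun k => ‖u k‖ₑ * ‖c k‖ₑ) (fun _ _ => zero_le)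
      (Finset.mem_univ k)
  have term₂ : ∀ {c : Fin d × Fin d → ℝ} {u : Fin d → ℝ} (p : Fin d × Fin d),
      ‖c p‖ₑ * (‖u p.1‖ₑ * ‖u p.2‖ₑ) ≤ quadAbs c u := fun {c u} p => by
    rw [mul_comm]
    exact Finset.single_le_sum (f := fun p : Fin d × Fin d => ‖u p.1‖ₑ * ‖u p.2‖ₑ * ‖c p‖ₑ)
      (fun _ _ => zero_le) (Finset.mem_univ p)
  have intg₁ : ∀ {u : (Fin n → Fin n) × Sample n d → Fin d → ℝ}, Measurable u →
      ∀ {r : (Fin n → Fin n) × Sample n d → ℝ≥0∞}, Measurable r →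
      ∫⁻ ω, remAbs (linAbs (c₁ ω) (u ω)) (quadAbs (c₂ ω) (u ω)) (r ω) ∂K ≠ ⊤ →
      ∀ k, Integrable (fun ω => G₁ k ω * u ω k) K := by
    intro u mu r mr fr k
    refine dom (measurable_remAbs (measurable_linAbs hc₁ mu) (measurable_quadAbs hc₂ mu) mr) fr
      (by fun_prop) fun ω => ?_
    rw [enorm_mul]
    calc _ ≤ ENNReal.ofReal C * ‖c₁ ω k‖ₑ * ‖u ω k‖ₑ := by gcongr; exact bG₁ k ω
      _ ≤ _ := by
        rw [mul_assoc]; refine mul_le_mul' le_rfl ?_; exact (term₁ k).trans (linAbs_le _ _ _)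
  have intg₂ : ∀ {u : (Fin n → Fin n) × Sample n d → Fin d → ℝ}, Measurable u →
      ∀ {r : (Fin n → Fin n) × Sample n d → ℝ≥0∞}, Measurable r →
      ∫⁻ ω, remAbs (linAbs (c₁ ω) (u ω)) (quadAbs (c₂ ω) (u ω)) (r ω) ∂K ≠ ⊤ →
      ∀ p : Fin d × Fin d, Integrable (fun ω => G₂ p ω * (u ω p.1 * u ω p.2)) K := by
    intro u mu r mr fr p
    refine dom (measurable_remAbs (measurable_linAbs hc₁ mu) (measurable_quadAbs hc₂ mu) mr) fr
      (by fun_prop) fun ω => ?_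
    rw [enorm_mul, enorm_mul]
    calc _ ≤ ENNReal.ofReal C * (‖c₂ ω p‖ₑ + ‖c₁ ω p.1‖ₑ * ‖c₁ ω p.2‖ₑ)
          * (‖u ω p.1‖ₑ * ‖u ω p.2‖ₑ) := by gcongr; exact bG₂ p ω
      _ = ENNReal.ofReal C * (‖c₂ ω p‖ₑ * (‖u ω p.1‖ₑ * ‖u ω p.2‖ₑ)
          + (‖c₁ ω p.1‖ₑ * ‖u ω p.1‖ₑ) * (‖c₁ ω p.2‖ₑ * ‖u ω p.2‖ₑ)) := by ring
      _ ≤ _ := by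
        gcongr
        exact (add_le_add (term₂ p) (mul_le_mul' (term₁ _) (term₁ _))).trans (quadAbs_add_le _ _ _)
  have intg₃ : ∀ {u : (Fin n → Fin n) × Sample n d → Fin d → ℝ}, Measurable u →
      ∀ {r : (Fin n → Fin n) × Sample n d → ℝ≥0∞}, Measurable r →
      ∫⁻ ω, remAbs (linAbs (c₁ ω) (u ω)) (quadAbs (c₂ ω) (u ω)) (r ω) ∂K ≠ ⊤ →
      ∀ q : Fin d × Fin d × Fin d,
        Integrable (fun ω => G₃ q ω * (u ω q.1 * (u ω q.2.1 * u ω q.2.2))) K := by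
    intro u mu r mr fr q
    refine dom (measurable_remAbs (measurable_linAbs hc₁ mu) (measurable_quadAbs hc₂ mu) mr) fr
      (by fun_prop) fun ω => ?_
    rw [enorm_mul, enorm_mul, enorm_mul]
    calc _ ≤ ENNReal.ofReal C * (‖c₁ ω q.1‖ₑ * ‖c₂ ω q.2‖ₑ)
          * (‖u ω q.1‖ₑ * (‖u ω q.2.1‖ₑ * ‖u ω q.2.2‖ₑ)) := by gcongr; exact bG₃ q ω
      _ = ENNReal.ofReal C * ((‖c₁ ω q.1‖ₑ * ‖u ω q.1‖ₑ)
          * (‖c₂ ω q.2‖ₑ * (‖u ω q.2.1‖ₑ * ‖u ω q.2.2‖ₑ))) := by ring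
      _ ≤ _ := by
        refine mul_le_mul' le_rfl ?_
        exact (mul_le_mul' (term₁ _) (term₂ _)).trans (mul_quadAbs_le _ _ _)
  set S₁ := fun ω => (∑ k, G₁ k ω * uY ω k) - ∑ k, G₁ k ω * uZ ω k with hS₁
  set S₂ := fun ω => (∑ p : Fin d × Fin d, G₂ p ω * (uY ω p.1 * uY ω p.2))
    - ∑ p : Fin d × Fin d, G₂ p ω * (uZ ω p.1 * uZ ω p.2) with hS₂
  set S₃ := fun ω =>
    (∑ q : Fin d × Fin d × Fin d, G₃ q ω * (uY ω q.1 * (uY ω q.2.1 * uY ω q.2.2)))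
    - ∑ q : Fin d × Fin d × Fin d, G₃ q ω * (uZ ω q.1 * (uZ ω q.2.1 * uZ ω q.2.2)) with hS₃
  have intS₁ : Integrable S₁ K :=
    (integrable_finsetSum _ fun k _ => intg₁ muY hrY finY k).sub
      (integrable_finsetSum _ fun k _ => intg₁ muZ hrZ finZ k)
  have intS₂ : Integrable S₂ K :=
    (integrable_finsetSum _ fun k _ => intg₂ muY hrY finY k).sub
      (integrable_finsetSum _ fun k _ => intg₂ muZ hrZ finZ k)
  have intS₃ : Integrable S₃ K :=
    (integrable_finsetSum _ fun k _ => intg₃ muY hrY finY k).sub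
      (integrable_finsetSum _ fun k _ => intg₃ muZ hrZ finZ k)
  set E := fun ω => h (fY ω) - h (fZ ω) - (S₁ ω + S₂ ω + S₃ ω) with hE
  have rem : ∀ (ω : (Fin n → Fin n) × Sample n d) (u : Fin d → ℝ) (F : ℝ) (r : ℝ≥0∞),
      ‖F - F₀ ω - lin (c₁ ω) u - quad (c₂ ω) u / 2‖ₑ ≤ r →
      ‖h F - h (F₀ ω) - (∑ k, G₁ k ω * u k + ∑ p : Fin d × Fin d, G₂ p ω * (u p.1 * u p.2)
        + ∑ q : Fin d × Fin d × Fin d, G₃ q ω * (u q.1 * (u q.2.1 * u q.2.2)))‖ₑ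
      ≤ ENNReal.ofReal (20 * C) * remAbs (linAbs (c₁ ω) u) (quadAbs (c₂ ω) u) r := by
    intro ω u F r hr
    have := H.enorm_expansion_le (F₀ ω) (lin (c₁ ω) u) (quad (c₂ ω) u)
      (F - F₀ ω - lin (c₁ ω) u - quad (c₂ ω) u / 2)
    rw [expansion_eq_sums, show F₀ ω + (lin (c₁ ω) u + quad (c₂ ω) u / 2
      + (F - F₀ ω - lin (c₁ ω) u - quad (c₂ ω) u / 2)) = F by ring] at this
    refine this.trans ?_
    gcongr
    exact remAbs_mono (enorm_lin_le _ _) (enorm_quad_le _ _) hr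
  have bE : ∀ ω, ‖E ω‖ₑ ≤ ENNReal.ofReal (20 * C) * (remY ω + remZ ω) := by
    intro ω
    have h1 := rem ω (uY ω) (fY ω) (rY ω) (bY ω)
    have h2 := rem ω (uZ ω) (fZ ω) (rZ ω) (bZ ω)
    rw [mul_add]
    refine le_trans ?_ (add_le_add h1 h2)
    -- The common base value `h (F₀ ω)` cancels between the two expansions.
    refine le_of_eq_of_le ?_ (enorm_sub_le)
    congr 1
    simp only [hE, hS₁, hS₂, hS₃]
    ring
  have mE : Measurable E := by fun_prop
  have bintE : ∫⁻ ω, ‖E ω‖ₑ ∂K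
      ≤ ENNReal.ofReal (20 * C) * ((∫⁻ ω, remY ω ∂K) + ∫⁻ ω, remZ ω ∂K) := by
    rw [← lintegral_add_left mremY,
      ← lintegral_const_mul _ (show Measurable fun ω => remY ω + remZ ω from mremY.add mremZ)]
    exact lintegral_mono bE
  have intE : Integrable E K := ⟨mE.aestronglyMeasurable, bintE.trans_lt
    (ENNReal.mul_lt_top ENNReal.ofReal_lt_top (ENNReal.add_lt_top.2 ⟨finY.lt_top, finZ.lt_top⟩))⟩
  have hD : (fun ω => h (fY ω) - h (fZ ω)) = fun ω => (S₁ ω + S₂ ω + S₃ ω) + E ω := by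
    funext ω; simp only [hE]; ring
  have intS₁₂ : Integrable (fun ω => S₁ ω + S₂ ω) K := intS₁.add intS₂
  have intS : Integrable (fun ω => S₁ ω + S₂ ω + S₃ ω) K := intS₁₂.add intS₃
  rw [hD]
  refine ⟨intS.add intE, ?_⟩
  rw [integral_add intS intE, integral_add intS₁₂ intS₃, integral_add intS₁ intS₂]
  -- First moments match exactly: `v - mean ν` has mean zero under `ν`, and the residuals `ζ` sum to
  -- zero.
  have z₁ : ∫ ω, S₁ ω ∂K = 0 := by
    rw [← enorm_eq_zero]
    refine le_antisymm ?_ zero_le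
    refine (enorm_integral_moment_swap_le ν Finset.univ mG₁ iG₁
      (φ := fun k v => v k - mean ν k) (fun k => by fun_prop) (fun k j => ζ j k)
      (fun k _ => intg₁ muY hrY finY k) (fun k _ => intg₁ muZ hrZ finZ k)).trans_eq ?_
    refine Finset.sum_eq_zero fun k _ => ?_
    have hk : ∫ v, (v k - mean ν k) ∂(ν : Measure (Fin d → ℝ)) = 0 := by
      have hi : Integrable (fun v : Fin d → ℝ => v k) (ν : Measure (Fin d → ℝ)) := hν.eval k
      rw [integral_sub hi (integrable_const _), integral_const, mean, eval_integral fun k => hν.eval k]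
      simp
    rw [hk, hζ k]
    simp
  have z₂ : ‖∫ ω, S₂ ω ∂K‖ₑ ≤ ENNReal.ofReal (20 * C) *
      ∑ p, (∫⁻ ω, (‖c₂ ω p‖ₑ + ‖c₁ ω p.1‖ₑ * ‖c₁ ω p.2‖ₑ) ∂K) * ‖momentGap₂ ν ζ p‖ₑ := by
    refine (enorm_integral_moment_swap_le ν Finset.univ mG₂ iG₂
      (φ := fun p v => (v p.1 - mean ν p.1) * (v p.2 - mean ν p.2)) (fun k => by fun_prop)
      (fun p j => ζ j p.1 * ζ j p.2)
      (fun k _ => intg₂ muY hrY finY k) (fun k _ => intg₂ muZ hrZ finZ k)).trans ?_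
    rw [Finset.mul_sum]
    refine Finset.sum_le_sum fun p _ => ?_
    rw [← mul_assoc, ← lintegral_const_mul _ (by fun_prop)]
    refine mul_le_mul' (lintegral_mono fun ω => (bG₂ p ω).trans ?_) le_rfl
    gcongr
    linarith
  have z₃ : ‖∫ ω, S₃ ω ∂K‖ₑ ≤ ENNReal.ofReal (20 * C) * ∑ q : Fin d × Fin d × Fin d,
      (∫⁻ ω, ‖c₁ ω q.1‖ₑ * ‖c₂ ω q.2‖ₑ ∂K) * ‖momentGap₃ ν ζ q‖ₑ := by
    refine (enorm_integral_moment_swap_le ν Finset.univ mG₃ iG₃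
      (φ := fun q v => (v q.1 - mean ν q.1) * ((v q.2.1 - mean ν q.2.1) * (v q.2.2 - mean ν q.2.2)))
      (fun k => by fun_prop)
      (fun q j => ζ j q.1 * (ζ j q.2.1 * ζ j q.2.2))
      (fun k _ => intg₃ muY hrY finY k) (fun k _ => intg₃ muZ hrZ finZ k)).trans ?_
    rw [Finset.mul_sum]
    refine Finset.sum_le_sum fun p _ => ?_
    rw [← mul_assoc, ← lintegral_const_mul _ (by fun_prop)]
    refine mul_le_mul' (lintegral_mono fun ω => (bG₃ p ω).trans ?_) le_rfl
    gcongr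
    linarith
  rw [z₁, zero_add, mul_add, mul_add]
  refine (enorm_add_le _ _).trans (add_le_add ((enorm_add_le _ _).trans (add_le_add z₂ z₃)) ?_)
  exact (enorm_integral_le_lintegral_enorm _).trans bintE

end Step

end RobustBootstrap

/-! ### The exchange chain and the comparison conditional on the data. -/

namespace RobustBootstrap

variable {n d : ℕ}

/-- The sample whose entries before `i` are fresh, whose `i`-th entry is `w`, and whose entries
after `i` are resampled from `z`. -/
def interpAt (i : Fin n) (z : Sample n d) (w : Fin d → ℝ) (ω : (Fin n → Fin n) × Sample n d) :
    Sample n d :=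
  fun j => if j < i then ω.2 j else if j = i then w else z (ω.1 j)

/-- The sample whose first `k` entries are fresh, the others being resampled from `z`. -/
def chain (k : ℕ) (z : Sample n d) (ω : (Fin n → Fin n) × Sample n d) : Sample n d :=
  fun j => if (j : ℕ) < k then ω.2 j else z (ω.1 j)

/-- Filling slot `i` with the fresh vector completes `i + 1` exchanges, while filling it with the
resampled one leaves only `i`. Consecutive links therefore share an endpoint and the sum over `i`
telescopes. -/
lemma interpAt_fresh (i : Fin n) (z : Sample n d) (ω : (Fin n → Fin n) × Sample n d) :
    interpAt i z (ω.2 i) ω = chain (i + 1) z ω := by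
  funext j
  simp only [interpAt, chain, Fin.lt_def, Fin.ext_iff]
  split_ifs with h1 h2 h3 h4 h5 <;> first | rfl | omega | skip
  rw [Fin.ext h3]

lemma interpAt_resampled (i : Fin n) (z : Sample n d) (ω : (Fin n → Fin n) × Sample n d) :
    interpAt i z (z (ω.1 i)) ω = chain i z ω := by
  funext j
  simp only [interpAt, chain, Fin.lt_def, Fin.ext_iff]
  split_ifs with h1 h2 <;> first | rfl | skip
  rw [Fin.ext h2]

lemma sum_chain_sub (z : Sample n d) (ω : (Fin n → Fin n) × Sample n d) (H : Sample n d → ℝ) :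
    ∑ i : Fin n, (H (interpAt i z (ω.2 i) ω) - H (interpAt i z (z (ω.1 i)) ω))
      = H ω.2 - H (resample z ω.1) := by
  simp only [interpAt_fresh, interpAt_resampled]
  rw [Fin.sum_univ_eq_sum_range (fun k => H (chain (k + 1) z ω) - H (chain k z ω)),
    Finset.sum_range_sub (fun k => H (chain k z ω))]
  have h1 : chain n z ω = ω.2 := by funext j; simp [chain]
  have h0 : chain 0 z ω = resample z ω.1 := by funext j; simp [chain, resample]
  rw [h1, h0]

lemma interpAt_add (i : Fin n) (z : Sample n d) (w u : Fin d → ℝ)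
    (ω : (Fin n → Fin n) × Sample n d) :
    interpAt i z (w + u) ω = interpAt i z w ω + atIndex i u := by
  funext j
  by_cases hj : j = i
  · subst hj; simp [interpAt]
  · simp [interpAt, hj]

/-- Slot `i` holds the fixed vector `w`; fresh vectors enter strictly before it and resampling
indices strictly after it. -/
lemma indep_interpAt (i : Fin n) (z : Sample n d) (w : Fin d → ℝ) (H : Sample n d → ℝ) :
    Indep i fun ω => H (interpAt i z w ω) := by
  intro J y
  constructor
  · intro a
    dsimp only
    congr 1
    funext j
    simp only [interpAt]
    split_ifs with h1 h2 <;> first | rfl | skip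
    rw [Function.update_of_ne h2]
  · intro a
    dsimp only
    congr 1
    funext j
    simp only [interpAt]
    split_ifs with h1 h2 <;> first | rfl | skip
    rw [Function.update_of_ne h1.ne]

/-- The data recentered at the population mean. -/
noncomputable def recenter (ν : ProbabilityMeasure (Fin d → ℝ)) (x : Sample n d) : Sample n d :=
  shift x (mean ν - sampleMean x)

/-- The data recentered at zero. -/
noncomputable def residual (x : Sample n d) : Sample n d := fun j => x j - sampleMean x

lemma recenter_apply (ν : ProbabilityMeasure (Fin d → ℝ)) (x : Sample n d) (j : Fin n) :
    recenter ν x j = mean ν + residual x j := by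
  simp only [recenter, shift, residual]; abel

/-- This centering is why the first-order terms of the exchange cancel exactly rather than up to
n^{-1/2}. -/
lemma sum_residual [NeZero n] (x : Sample n d) (k : Fin d) : ∑ j, residual x j k = 0 := by
  have : (n : ℝ) ≠ 0 := NeZero.ne _
  simp [residual, sampleMean, Finset.sum_sub_distrib]
  field_simp
  simp

lemma resample_recenter (ν : ProbabilityMeasure (Fin d → ℝ)) (x : Sample n d)
    (J : Fin n → Fin n) : resample (recenter ν x) J = centeredResample (mean ν) x J := rfl

section Coefficients

variable (ν : ProbabilityMeasure (Fin d → ℝ)) (f : Sample n d → ℝ) (i : Fin n)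
  (ω : Sample n d × (Fin n → Fin n) × Sample n d)

/-- The interpolating sample with the population mean in position `i`. -/
noncomputable def basePt : Sample n d := interpAt i (recenter ν ω.1) (mean ν) ω.2

/-- The first partial derivatives at `basePt`. -/
noncomputable def coef₁ : Fin d → ℝ := fun k => partialD i k f (basePt ν i ω)

/-- The second partial derivatives at `basePt`. -/
noncomputable def coef₂ : Fin d × Fin d → ℝ :=
  fun p => partialD i p.2 (partialD i p.1 f) (basePt ν i ω)

/-- The largest third partial derivatives on the segment from `basePt` in direction `u`. -/
noncomputable def coef₃ (u : Fin d → ℝ) (q : Fin d × Fin d × Fin d) : ℝ≥0∞ :=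
  ⨆ r ∈ Set.Icc (0 : ℝ) 1, ‖partialD i q.2.2 (partialD i q.2.1 (partialD i q.1 f))
    (basePt ν i ω + r • atIndex i u)‖ₑ

/-- The bound for the Taylor remainder in direction `u`. -/
noncomputable def remBound (u : Fin d → ℝ) : ℝ≥0∞ :=
  ∑ q : Fin d × Fin d × Fin d, ‖u q.1‖ₑ * ‖u q.2.1‖ₑ * ‖u q.2.2‖ₑ * coef₃ ν f i ω u q

/-- The deviation of the fresh vector from the population mean. -/
noncomputable def devY : Fin d → ℝ := ω.2.2 i - mean ν

/-- The deviation of the resampled vector from the sample mean. -/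
noncomputable def devZ : Fin d → ℝ := residual ω.1 (ω.2.1 i)

/-- The error of the `i`-th exchange step. -/
noncomputable def stepErr : ℝ≥0∞ :=
  stepBound (momentGap₂ ν (residual ω.1)) (momentGap₃ ν (residual ω.1)) (coef₁ ν f i ω)
    (coef₂ ν f i ω) (devY ν i ω) (devZ i ω) (remBound ν f i ω (devY ν i ω))
    (remBound ν f i ω (devZ i ω))

/-- The conditional error of the exchange argument, given the data. -/
noncomputable def lindErr (x : Sample n d) : ℝ≥0∞ :=
  ∑ i, ∫⁻ ω, stepErr ν f i (x, ω) ∂(auxLaw n ν)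

lemma enorm_taylor_basePt_le {f : Sample n d → ℝ} (hf : ContDiff ℝ 3 f) (u : Fin d → ℝ) :
    ‖f (interpAt i (recenter ν ω.1) (mean ν + u) ω.2) - f (basePt ν i ω)
        - lin (coef₁ ν f i ω) u - quad (coef₂ ν f i ω) u / 2‖ₑ ≤ remBound ν f i ω u := by
  have := enorm_taylor_partialD_le hf i (basePt ν i ω) u
  rw [interpAt_add]
  simp only [remBound, coef₃, lin, quad, coef₁, coef₂, Fintype.sum_prod_type]
  exact this

end Coefficients

/-- The index space is finite and discrete, so evaluation at a random index is jointly continuous.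
-/
lemma continuous_apply_index (j : Fin n) :
    Continuous fun ω : Sample n d × (Fin n → Fin n) × Sample n d => ω.1 (ω.2.1 j) := by
  have : Continuous fun p : Sample n d × Fin n => p.1 p.2 :=
    continuous_prod_of_discrete_right.2 fun b => continuous_apply b
  exact this.comp (f := fun ω : Sample n d × (Fin n → Fin n) × Sample n d => (ω.1, ω.2.1 j))
    (by fun_prop)

lemma continuous_sampleMean : Continuous (sampleMean : Sample n d → Fin d → ℝ) := by
  unfold sampleMean; fun_prop

lemma continuous_devZ (i : Fin n) :
    Continuous fun ω : Sample n d × (Fin n → Fin n) × Sample n d => devZ i ω :=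
  (continuous_apply_index i).sub (continuous_sampleMean.comp continuous_fst)

lemma continuous_devY (ν : ProbabilityMeasure (Fin d → ℝ)) (i : Fin n) :
    Continuous fun ω : Sample n d × (Fin n → Fin n) × Sample n d => devY ν i ω := by
  unfold devY; fun_prop

lemma continuous_basePt (ν : ProbabilityMeasure (Fin d → ℝ)) (i : Fin n) :
    Continuous fun ω : Sample n d × (Fin n → Fin n) × Sample n d => basePt ν i ω := by
  refine continuous_pi fun j => ?_
  simp only [basePt, interpAt]
  split_ifs
  · fun_prop
  · fun_prop
  · simp only [recenter_apply]
    exact continuous_const.add (continuous_devZ j)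

variable {f : Sample n d → ℝ}

lemma ContDiff.partialD_two (hf : ContDiff ℝ 3 f) (i : Fin n) (k : Fin d) :
    ContDiff ℝ 2 (partialD i k f) := contDiff_partialD (m := 2) hf i k

lemma ContDiff.partialD_one (hf : ContDiff ℝ 3 f) (i : Fin n) (k k' : Fin d) :
    ContDiff ℝ 1 (partialD i k (partialD i k' f)) :=
  contDiff_partialD (m := 1) (ContDiff.partialD_two hf i k') i k

lemma ContDiff.partialD_zero (hf : ContDiff ℝ 3 f) (i : Fin n) (k k' k'' : Fin d) :
    ContDiff ℝ 0 (partialD i k (partialD i k' (partialD i k'' f))) :=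
  contDiff_partialD (m := 0) (ContDiff.partialD_one hf i k' k'') i k

variable (ν : ProbabilityMeasure (Fin d → ℝ))

lemma measurable_coef₁ (hf : ContDiff ℝ 3 f) (i : Fin n) : Measurable (coef₁ ν f i) :=
  measurable_pi_iff.2 fun k =>
    ((ContDiff.partialD_two hf i k).continuous.comp (continuous_basePt ν i)).measurable

lemma measurable_coef₂ (hf : ContDiff ℝ 3 f) (i : Fin n) : Measurable (coef₂ ν f i) :=
  measurable_pi_iff.2 fun p =>
    ((ContDiff.partialD_one hf i p.2 p.1).continuous.comp (continuous_basePt ν i)).measurable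

/-- The supremum is uncountable, but a supremum of continuous functions is lower semicontinuous,
hence measurable. -/
lemma measurable_coef₃ (hf : ContDiff ℝ 3 f) (i : Fin n)
    {u : Sample n d × (Fin n → Fin n) × Sample n d → Fin d → ℝ} (hu : Continuous u)
    (q : Fin d × Fin d × Fin d) : Measurable fun ω => coef₃ ν f i ω (u ω) q := by
  refine LowerSemicontinuous.measurable (lowerSemicontinuous_biSup fun r _ => ?_)
  refine Continuous.lowerSemicontinuous ?_
  refine Continuous.enorm ((ContDiff.partialD_zero hf i _ _ _).continuous.comp ?_)
  refine (continuous_basePt ν i).add (Continuous.const_smul ?_ r)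
  exact continuous_pi fun j => (continuous_pi_iff.1
    ((continuous_single (A := fun _ : Fin n => Fin d → ℝ) i).comp hu) j)

lemma measurable_remBound (hf : ContDiff ℝ 3 f) (i : Fin n)
    {u : Sample n d × (Fin n → Fin n) × Sample n d → Fin d → ℝ} (hu : Continuous u) :
    Measurable fun ω => remBound ν f i ω (u ω) := by
  refine Finset.measurable_sum _ fun q _ => ?_
  have := measurable_coef₃ ν hf i hu q
  have hu' := hu.measurable
  fun_prop

lemma continuous_residual (j : Fin n) : Continuous fun x : Sample n d => residual x j :=
  (continuous_apply j).sub continuous_sampleMean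

lemma measurable_momentGap₂ (p : Fin d × Fin d) :
    Measurable fun x : Sample n d => momentGap₂ ν (residual x) p := by
  have : ∀ j, Measurable fun x : Sample n d => residual x j := fun j =>
    (continuous_residual j).measurable
  unfold momentGap₂
  fun_prop

lemma measurable_momentGap₃ (q : Fin d × Fin d × Fin d) :
    Measurable fun x : Sample n d => momentGap₃ ν (residual x) q := by
  have : ∀ j, Measurable fun x : Sample n d => residual x j := fun j =>
    (continuous_residual j).measurable
  unfold momentGap₃
  fun_prop

lemma measurable_stepErr (hf : ContDiff ℝ 3 f) (i : Fin n) : Measurable (stepErr ν f i) := by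
  have m1 := measurable_coef₁ ν hf i
  have m2 := measurable_coef₂ ν hf i
  have mY := (continuous_devY ν i).measurable
  have mZ := (continuous_devZ (d := d) i).measurable
  have mg₂ : ∀ p, Measurable fun ω : Sample n d × (Fin n → Fin n) × Sample n d =>
      momentGap₂ ν (residual ω.1) p := fun p => (measurable_momentGap₂ ν p).comp measurable_fst
  have mg₃ : ∀ p, Measurable fun ω : Sample n d × (Fin n → Fin n) × Sample n d =>
      momentGap₃ ν (residual ω.1) p := fun p => (measurable_momentGap₃ ν p).comp measurable_fst
  refine Measurable.add (Measurable.add ?_ ?_) (Measurable.add ?_ ?_)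
  · fun_prop
  · fun_prop
  · exact measurable_remAbs (measurable_linAbs m1 mY) (measurable_quadAbs m2 mY)
      (measurable_remBound ν hf i (continuous_devY ν i))
  · exact measurable_remAbs (measurable_linAbs m1 mZ) (measurable_quadAbs m2 mZ)
      (measurable_remBound ν hf i (continuous_devZ i))

lemma measurable_lindErr [NeZero n] (hf : ContDiff ℝ 3 f) : Measurable (lindErr ν f) :=
  Finset.measurable_sum _ fun i _ => (measurable_stepErr ν hf i).lintegral_prod_right'

/-- Given the data, the bootstrap law and the true law of a smooth statistic are close. -/
lemma lindeberg_conditional [NeZero n]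
    (hν : Integrable (fun v => v) (ν : Measure (Fin d → ℝ))) (hf : ContDiff ℝ 3 f)
    {x : Sample n d} (hx : lindErr ν f x ≠ ⊤) {h h₁ h₂ h₃ : ℝ → ℝ} {C : ℝ}
    (H : TestFun h h₁ h₂ h₃ C) :
    Integrable (fun ω : (Fin n → Fin n) × Sample n d =>
      h (f ω.2) - h (f (centeredResample (mean ν) x ω.1))) (auxLaw n ν) ∧
    ‖∫ ω, (h (f ω.2) - h (f (centeredResample (mean ν) x ω.1))) ∂(auxLaw n ν)‖ₑ
      ≤ ENNReal.ofReal (20 * C) * lindErr ν f x := by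
  have slice : Measurable fun ω : (Fin n → Fin n) × Sample n d => (x, ω) := measurable_prodMk_left
  have hfin : ∀ i, ∫⁻ ω, stepErr ν f i (x, ω) ∂(auxLaw n ν) ≠ ⊤ := fun i =>
    ((ENNReal.sum_lt_top.1 (lt_top_iff_ne_top.2 hx)) i (Finset.mem_univ i)).ne
  have minterp : ∀ (i : Fin n) {w : (Fin n → Fin n) × Sample n d → Fin d → ℝ}, Measurable w →
      Measurable fun ω => f (interpAt i (recenter ν x) (w ω) ω) := by
    intro i w hw
    refine hf.continuous.measurable.comp (measurable_pi_iff.2 fun j => ?_)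
    simp only [interpAt]
    split_ifs
    · fun_prop
    · exact hw
    · exact (measurable_of_finite (recenter ν x)).comp (by fun_prop)
  have step := fun i : Fin n => lindeberg_step ν hν (sum_residual x) i
    (F₀ := fun ω => f (basePt ν i (x, ω)))
    (fY := fun ω => f (interpAt i (recenter ν x) (ω.2 i) ω))
    (fZ := fun ω => f (interpAt i (recenter ν x) (recenter ν x (ω.1 i)) ω))
    (c₁ := fun ω => coef₁ ν f i (x, ω)) (c₂ := fun ω => coef₂ ν f i (x, ω))
    (rY := fun ω => remBound ν f i (x, ω) (devY ν i (x, ω)))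
    (rZ := fun ω => remBound ν f i (x, ω) (devZ i (x, ω)))
    (minterp i measurable_const) (minterp i (by fun_prop))
    (minterp i ((measurable_of_finite (recenter ν x)).comp (by fun_prop)))
    ((measurable_coef₁ ν hf i).comp slice) ((measurable_coef₂ ν hf i).comp slice)
    ((measurable_remBound ν hf i (continuous_devY ν i)).comp slice)
    ((measurable_remBound ν hf i (continuous_devZ i)).comp slice)
    (indep_interpAt i (recenter ν x) (mean ν) f) (fun k => indep_interpAt i (recenter ν x) (mean ν) (partialD i k f))
    (fun p => indep_interpAt i (recenter ν x) (mean ν) (partialD i p.2 (partialD i p.1 f)))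
    (fun ω => by
      have := enorm_taylor_basePt_le ν i (x, ω) hf (devY ν i (x, ω))
      rw [show mean ν + devY ν i (x, ω) = ω.2 i by simp [devY]] at this
      exact this)
    (fun ω => by
      rw [recenter_apply]
      exact enorm_taylor_basePt_le ν i (x, ω) hf (devZ i (x, ω)))
    (hfin i) H
  have tele : (fun ω : (Fin n → Fin n) × Sample n d =>
      h (f ω.2) - h (f (centeredResample (mean ν) x ω.1))) = fun ω => ∑ i : Fin n,
        (h (f (interpAt i (recenter ν x) (ω.2 i) ω))
          - h (f (interpAt i (recenter ν x) (recenter ν x (ω.1 i)) ω))) := by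
    funext ω
    rw [sum_chain_sub (recenter ν x) ω (fun s => h (f s)), resample_recenter]
  rw [tele]
  refine ⟨integrable_finsetSum _ fun i _ => (step i).1, ?_⟩
  rw [integral_finsetSum _ fun i _ => (step i).1, lindErr, Finset.mul_sum]
  exact (enorm_sum_le _ _).trans (Finset.sum_le_sum fun i _ => (step i).2)

end RobustBootstrap

/-! ### Hölder inequalities and fluctuations of empirical averages. -/

namespace RobustBootstrap

section Holder

variable {Ω : Type*} [MeasurableSpace Ω] {μ : Measure Ω}

lemma eLpNorm_enorm_eq (f : Ω → ℝ) (p : ℝ≥0∞) : eLpNorm (fun ω => ‖f ω‖ₑ) p μ = eLpNorm f p μ :=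
  eLpNorm_congr_enorm_ae (.of_forall fun ω => by simp)

lemma lintegral_pow_eq_eLpNorm (f : Ω → ℝ≥0∞) {k : ℕ} (hk : k ≠ 0) :
    ∫⁻ ω, f ω ^ k ∂μ = eLpNorm f k μ ^ k := by
  rw [eLpNorm_eq_lintegral_rpow_enorm_toReal (by simpa using hk) (by simp), ENNReal.toReal_natCast,
    ← ENNReal.rpow_natCast, ← ENNReal.rpow_mul, one_div, inv_mul_cancel₀ (by simpa using hk),
    ENNReal.rpow_one]
  simp

/-- Hölder's inequality for functions with values in `[0, ∞]`. -/
lemma eLpNorm_mul_le_ennreal {f g : Ω → ℝ≥0∞} (hf : Measurable f) (hg : Measurable g)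
    (p q r : ℝ≥0∞) (h : 0 < p.toReal ∧ 0 < q.toReal ∧ 0 < r.toReal ∧
      r.toReal⁻¹ = p.toReal⁻¹ + q.toReal⁻¹) :
    eLpNorm (fun ω => f ω * g ω) r μ ≤ eLpNorm f p μ * eLpNorm g q μ := by
  obtain ⟨pp, pq, pr, hR⟩ := h
  simp only [← one_div] at hR
  obtain ⟨hp0, hp⟩ := ENNReal.toReal_pos_iff.1 pp
  obtain ⟨hq0, hq⟩ := ENNReal.toReal_pos_iff.1 pq
  obtain ⟨hr0, hr⟩ := ENNReal.toReal_pos_iff.1 pr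
  have hlt : r.toReal < p.toReal := by
    rw [← one_div_lt_one_div pp pr, hR]
    linarith [one_div_pos.2 pq]
  rw [eLpNorm_eq_lintegral_rpow_enorm_toReal hr0.ne' hr.ne,
    eLpNorm_eq_lintegral_rpow_enorm_toReal hp0.ne' hp.ne,
    eLpNorm_eq_lintegral_rpow_enorm_toReal hq0.ne' hq.ne]
  simpa using ENNReal.lintegral_Lp_mul_le_Lq_mul_Lr pr hlt hR μ hf.aemeasurable hg.aemeasurable

lemma eLpNorm_mul_le_real {f g : Ω → ℝ} (hf : Measurable f) (hg : Measurable g)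
    (p q r : ℝ≥0∞) (h : 0 < p.toReal ∧ 0 < q.toReal ∧ 0 < r.toReal ∧
      r.toReal⁻¹ = p.toReal⁻¹ + q.toReal⁻¹) :
    eLpNorm (fun ω => f ω * g ω) r μ ≤ eLpNorm f p μ * eLpNorm g q μ := by
  rw [← eLpNorm_enorm_eq, ← eLpNorm_enorm_eq f, ← eLpNorm_enorm_eq g]
  simp only [enorm_mul]
  exact eLpNorm_mul_le_ennreal hf.enorm hg.enorm p q r h

/-- Used to freeze the resampling index: for fixed `J` the resampled residual is one particular
residual, and the bound is the same for all of them. -/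
lemma eLpNorm_prod_le_of_slices {Ω' : Type*} [MeasurableSpace Ω'] {κ : Measure Ω'} [SFinite μ]
    [IsProbabilityMeasure κ] {F : Ω × Ω' → ℝ} (hF : Measurable F) {k : ℕ} (hk : k ≠ 0) {M : ℝ≥0∞}
    (h : ∀ w, eLpNorm (fun x => F (x, w)) k μ ≤ M) : eLpNorm F k (μ.prod κ) ≤ M := by
  rw [← ENNReal.pow_le_pow_left_iff hk, ← eLpNorm_enorm_eq, ← lintegral_pow_eq_eLpNorm _ hk,
    lintegral_prod_symm _ (by fun_prop)]
  calc _ ≤ ∫⁻ _, M ^ k ∂κ := lintegral_mono fun w => by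
        dsimp only
        rw [lintegral_pow_eq_eLpNorm (fun x => ‖F (x, w)‖ₑ) hk, eLpNorm_enorm_eq]
        exact pow_le_pow_left' (h w) k
    _ = M ^ k := by simp

end Holder

section Moments

variable {n d : ℕ} (ν : ProbabilityMeasure (Fin d → ℝ))

lemma measurePreserving_eval_iidLaw (j : Fin n) :
    MeasurePreserving (fun x : Sample n d => x j) (iidLaw n ν) (ν : Measure (Fin d → ℝ)) :=
  measurePreserving_eval (fun _ : Fin n => (ν : Measure (Fin d → ℝ))) j

lemma eLpNorm_eval {φ : (Fin d → ℝ) → ℝ} (hφ : Measurable φ) (j : Fin n) (p : ℝ≥0∞) :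
    eLpNorm (fun x : Sample n d => φ (x j)) p (iidLaw n ν)
      = eLpNorm φ p (ν : Measure (Fin d → ℝ)) :=
  eLpNorm_comp_measurePreserving hφ.aestronglyMeasurable (measurePreserving_eval_iidLaw ν j)

lemma eLpNorm_average_le [NeZero n] {Ω : Type*} [MeasurableSpace Ω] {μ : Measure Ω}
    {F : Fin n → Ω → ℝ} (hF : ∀ j, Measurable (F j)) {p M : ℝ≥0∞} (hp : 1 ≤ p)
    (h : ∀ j, eLpNorm (F j) p μ ≤ M) :
    eLpNorm (fun ω => (n : ℝ)⁻¹ * ∑ j, F j ω) p μ ≤ M := by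
  have e : (fun ω => (n : ℝ)⁻¹ * ∑ j, F j ω) = (n : ℝ)⁻¹ • ∑ j, F j := by
    funext ω; simp
  rw [e, eLpNorm_const_smul]
  calc _ ≤ ‖(n : ℝ)⁻¹‖ₑ * ∑ _j : Fin n, M := by
        gcongr
        exact (eLpNorm_sum_le (fun j _ => (hF j).aestronglyMeasurable) hp).trans
          (Finset.sum_le_sum fun j _ => h j)
    _ = M := by
        have hn : (n : ℝ) ≠ 0 := NeZero.ne _
        rw [enorm_inv hn, Finset.sum_const, Finset.card_univ, Fintype.card_fin, nsmul_eq_mul,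
          ← mul_assoc, show ‖(n : ℝ)‖ₑ = n by simp, ENNReal.inv_mul_cancel (by simpa using hn)
          (by simp), one_mul]

/-- The empirical average of a square-integrable function fluctuates at scale `n^{-1/2}`. -/
lemma eLpNorm_average_sub_le [NeZero n] {φ : (Fin d → ℝ) → ℝ} (hφ : Measurable φ)
    (hL : eLpNorm φ 2 (ν : Measure (Fin d → ℝ)) ≠ ⊤) :
    eLpNorm (fun x : Sample n d => (n : ℝ)⁻¹ * ∑ j, φ (x j) - ∫ v, φ v ∂(ν : Measure (Fin d → ℝ)))
      2 (iidLaw n ν) ≤ (n : ℝ≥0∞) ^ (-1 / 2 : ℝ) * eLpNorm φ 2 (ν : Measure (Fin d → ℝ)) := by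
  have hn : (n : ℝ) ≠ 0 := NeZero.ne _
  have mem : MemLp φ 2 (ν : Measure (Fin d → ℝ)) := ⟨hφ.aestronglyMeasurable, hL.lt_top⟩
  have memj : ∀ j : Fin n, MemLp (fun x : Sample n d => φ (x j)) 2 (iidLaw n ν) := fun j =>
    mem.comp_measurePreserving (measurePreserving_eval_iidLaw ν j)
  have intj : ∀ j : Fin n, ∫ x : Sample n d, φ (x j) ∂(iidLaw n ν) = ∫ v, φ v ∂(ν : Measure _) :=
    fun j => by
      rw [← (measurePreserving_eval_iidLaw (n := n) ν j).map_eq,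
        integral_map (measurable_pi_apply j).aemeasurable hφ.aestronglyMeasurable]
  set S : Sample n d → ℝ := ∑ j : Fin n, fun x => φ (x j) with hS
  have memS : MemLp S 2 (iidLaw n ν) := memLp_finsetSum' _ fun j _ => memj j
  -- Variances of independent summands add; after division by `n` this is the source of the rate
  -- n^{-1/2}.
  have hvar : Var[S; iidLaw n ν] = n * Var[φ; (ν : Measure (Fin d → ℝ))] := by
    rw [hS, IndepFun.variance_sum (fun j _ => memj j)]
    · have : ∀ j : Fin n, Var[fun x : Sample n d => φ (x j); iidLaw n ν]
          = Var[φ; (ν : Measure (Fin d → ℝ))] := fun j => by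
        rw [← (measurePreserving_eval_iidLaw (n := n) ν j).map_eq,
          variance_map hφ.aemeasurable (measurable_pi_apply j).aemeasurable]
        rfl
      simp [this]
    · intro j _ k _ hjk
      exact (iIndepFun_pi (μ := fun _ : Fin n => (ν : Measure (Fin d → ℝ))) (X := fun _ => φ)
        fun _ => hφ.aemeasurable).indepFun hjk
  have intS : ∫ x, (n : ℝ)⁻¹ * S x ∂(iidLaw n ν) = ∫ v, φ v ∂(ν : Measure (Fin d → ℝ)) := by
    rw [integral_const_mul, hS]
    simp only [Finset.sum_apply]
    rw [integral_finsetSum _ fun j _ => (memj j).integrable one_le_two]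
    simp [intj, hn]
  have key : eLpNorm (fun x : Sample n d => (n : ℝ)⁻¹ * ∑ j, φ (x j)
      - ∫ v, φ v ∂(ν : Measure (Fin d → ℝ))) 2 (iidLaw n ν) ^ 2
      = ENNReal.ofReal ((n : ℝ)⁻¹ * Var[φ; (ν : Measure (Fin d → ℝ))]) := by
    have h1 := lintegral_pow_eq_eLpNorm (μ := iidLaw n ν) (fun x : Sample n d =>
      ‖(n : ℝ)⁻¹ * ∑ j, φ (x j) - ∫ v, φ v ∂(ν : Measure (Fin d → ℝ))‖ₑ) two_ne_zero
    rw [eLpNorm_enorm_eq, Nat.cast_ofNat] at h1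
    have h2 : Var[fun x => (n : ℝ)⁻¹ * S x; iidLaw n ν]
        = (n : ℝ)⁻¹ * Var[φ; (ν : Measure (Fin d → ℝ))] := by
      rw [variance_const_mul, hvar]; field_simp
    rw [← h1, ← h2, (memS.const_mul _).ofReal_variance_eq, evariance, intS]
    simp [hS]
  have hvle : ENNReal.ofReal (Var[φ; (ν : Measure (Fin d → ℝ))])
      ≤ eLpNorm φ 2 (ν : Measure (Fin d → ℝ)) ^ 2 := by
    rw [← eLpNorm_enorm_eq, ← Nat.cast_ofNat (n := 2), ← lintegral_pow_eq_eLpNorm _ two_ne_zero]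
    refine (ENNReal.ofReal_le_ofReal (variance_le_expectation_sq mem.aestronglyMeasurable)).trans ?_
    simp only [Pi.pow_apply]
    rw [ofReal_integral_eq_lintegral_ofReal mem.integrable_sq (.of_forall fun _ => by positivity)]
    refine lintegral_mono fun v => ?_
    dsimp only
    rw [Real.enorm_eq_ofReal_abs, ← ENNReal.ofReal_pow (abs_nonneg _), sq_abs]
  rw [← ENNReal.pow_le_pow_left_iff two_ne_zero, key, mul_pow, ENNReal.ofReal_mul (by positivity),
    ← ENNReal.rpow_natCast, ← ENNReal.rpow_mul]
  norm_num
  rw [ENNReal.rpow_neg_one, ENNReal.ofReal_inv_of_pos (by positivity), ENNReal.ofReal_natCast]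
  gcongr

end Moments

end RobustBootstrap

/-! ### Gaps between population and empirical moments. -/

namespace RobustBootstrap

variable {n d : ℕ}

section Gaps

variable {ν : ProbabilityMeasure (Fin d → ℝ)}

lemma eLpNorm_coord_le_momentM (k : Fin d) :
    eLpNorm (fun v : Fin d → ℝ => v k) 12 (ν : Measure (Fin d → ℝ)) ≤ momentM ν k :=
  le_mul_of_one_le_left zero_le one_le_two

lemma integral_coord (hν : Integrable (fun v => v) (ν : Measure (Fin d → ℝ))) (k : Fin d) :
    ∫ v, v k ∂(ν : Measure (Fin d → ℝ)) = mean ν k := by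
  rw [mean, eval_integral fun k => hν.eval k]

/-- This explains the factor 2 in `momentM`: one copy of the norm pays for the coordinate and one,
since the mean is bounded by the L₁ norm, for its centering. -/
lemma eLpNorm_coord_sub_mean_le (hν : Integrable (fun v => v) (ν : Measure (Fin d → ℝ)))
    (k : Fin d) :
    eLpNorm (fun v : Fin d → ℝ => v k - mean ν k) 12 (ν : Measure (Fin d → ℝ))
      ≤ momentM ν k := by
  have hm : ‖mean ν k‖ₑ ≤ eLpNorm (fun v : Fin d → ℝ => v k) 12 (ν : Measure (Fin d → ℝ)) := by
    rw [← integral_coord hν]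
    refine (enorm_integral_le_lintegral_enorm _).trans ?_
    rw [← eLpNorm_one_eq_lintegral_enorm]
    exact eLpNorm_le_eLpNorm_of_exponent_le (by norm_num)
      (measurable_pi_apply k).aestronglyMeasurable
  refine (eLpNorm_sub_le (f := fun v : Fin d → ℝ => v k) (g := fun _ => mean ν k)
    (measurable_pi_apply k).aestronglyMeasurable
    aestronglyMeasurable_const (by norm_num)).trans ?_
  rw [eLpNorm_const _ (by norm_num) (NeZero.ne _), momentM, two_mul]
  refine add_le_add le_rfl ?_
  simpa using hm

lemma sampleMean_apply (x : Sample n d) (k : Fin d) :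
    sampleMean x k = (n : ℝ)⁻¹ * ∑ j, x j k := by
  simp [sampleMean]

lemma eLpNorm_sample_sub_mean_le (hν : Integrable (fun v => v) (ν : Measure (Fin d → ℝ)))
    (j : Fin n) (k : Fin d) :
    eLpNorm (fun x : Sample n d => x j k - mean ν k) 12 (iidLaw n ν) ≤ momentM ν k :=
  (eLpNorm_eval ν (φ := fun v => v k - mean ν k) (by fun_prop) j 12).trans_le
    (eLpNorm_coord_sub_mean_le hν k)

lemma measurable_residual (j : Fin n) (k : Fin d) :
    Measurable fun x : Sample n d => residual x j k :=
  (measurable_pi_apply k).comp (continuous_residual j).measurable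

lemma measurable_sampleMean (k : Fin d) : Measurable fun x : Sample n d => sampleMean x k :=
  (measurable_pi_apply k).comp continuous_sampleMean.measurable

/-- Same splitting as for population centering; Minkowski's inequality bounds the sample mean by the
norm of a single coordinate. -/
lemma eLpNorm_residual_le [NeZero n] (j : Fin n) (k : Fin d) :
    eLpNorm (fun x : Sample n d => residual x j k) 12 (iidLaw n ν) ≤ momentM ν k := by
  have h1 : ∀ j : Fin n, eLpNorm (fun x : Sample n d => x j k) 12 (iidLaw n ν)
      ≤ eLpNorm (fun v : Fin d → ℝ => v k) 12 (ν : Measure (Fin d → ℝ)) := fun j =>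
    (eLpNorm_eval ν (φ := fun v => v k) (by fun_prop) j 12).le
  refine (eLpNorm_sub_le (f := fun x : Sample n d => x j k) (g := fun x => sampleMean x k)
    (Measurable.aestronglyMeasurable (by fun_prop)) (measurable_sampleMean k).aestronglyMeasurable (by norm_num)).trans ?_
  rw [momentM, two_mul]
  refine add_le_add (h1 j) ?_
  simp only [sampleMean_apply]
  exact eLpNorm_average_le (fun j => by fun_prop) (by norm_num) h1

lemma eLpNorm_sampleMean_sub_mean_le [NeZero n]
    (hν : MemLp (fun v => v) 12 (ν : Measure (Fin d → ℝ))) (k : Fin d) :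
    eLpNorm (fun x : Sample n d => sampleMean x k - mean ν k) 2 (iidLaw n ν)
      ≤ (n : ℝ≥0∞) ^ (-1 / 2 : ℝ) * momentM ν k := by
  have h2 : eLpNorm (fun v : Fin d → ℝ => v k) 2 (ν : Measure (Fin d → ℝ))
      ≤ eLpNorm (fun v : Fin d → ℝ => v k) 12 (ν : Measure (Fin d → ℝ)) :=
    eLpNorm_le_eLpNorm_of_exponent_le (by norm_num) (measurable_pi_apply k).aestronglyMeasurable
  have := eLpNorm_average_sub_le (n := n) ν (φ := fun v => v k) (by fun_prop)
    (h2.trans_lt (hν.eval k).2).ne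
  simp only [sampleMean_apply]
  rw [integral_coord (hν.integrable (by norm_num))] at this
  exact this.trans (mul_le_mul' le_rfl (h2.trans (eLpNorm_coord_le_momentM k)))

lemma momentM_ne_top (hν : MemLp (fun v => v) 12 (ν : Measure (Fin d → ℝ))) (k : Fin d) :
    momentM ν k ≠ ⊤ := ENNReal.mul_ne_top (by simp) (hν.eval k).2.ne

lemma eLpNorm_mul_le_six {Ω : Type*} [MeasurableSpace Ω] {μ : Measure Ω} {f g : Ω → ℝ}
    (hf : Measurable f) (hg : Measurable g) {A B : ℝ≥0∞} (hA : eLpNorm f 12 μ ≤ A)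
    (hB : eLpNorm g 12 μ ≤ B) : eLpNorm (fun ω => f ω * g ω) 6 μ ≤ A * B :=
  (eLpNorm_mul_le_real hf hg 12 12 6 (by norm_num)).trans (mul_le_mul' hA hB)

lemma eLpNorm_mul_le_three_halves {Ω : Type*} [MeasurableSpace Ω] {μ : Measure Ω} {f g : Ω → ℝ}
    (hf : Measurable f) (hg : Measurable g) {A B : ℝ≥0∞} (hA : eLpNorm f 2 μ ≤ A)
    (hB : eLpNorm g 6 μ ≤ B) : eLpNorm (fun ω => f ω * g ω) (3 / 2) μ ≤ A * B :=
  (eLpNorm_mul_le_real hf hg 2 6 (3 / 2) (by norm_num)).trans (mul_le_mul' hA hB)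

lemma one_le_three_halves : (1 : ℝ≥0∞) ≤ 3 / 2 := by
  rw [ENNReal.le_div_iff_mul_le (by simp) (by simp)]; norm_num

lemma three_halves_le_two : (3 / 2 : ℝ≥0∞) ≤ 2 :=
  ENNReal.div_le_of_le_mul (by norm_num)

/-- Replacing population centering by sample centering one factor at a time leaves products
containing `sampleMean - mean`, which is n^{-1/2} in L₂; the other factor is bounded in L₆, hence
the exponent 3/2. The ordinary fluctuation of the average of centered products adds one more term of
the same order. -/
lemma eLpNorm_momentGap₂_le [NeZero n]
    (hν : MemLp (fun v => v) 12 (ν : Measure (Fin d → ℝ))) (p : Fin d × Fin d) :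
    eLpNorm (fun x : Sample n d => momentGap₂ ν (residual x) p) (3 / 2) (iidLaw n ν)
      ≤ 4 * ((n : ℝ≥0∞) ^ (-1 / 2 : ℝ) * (momentM ν p.1 * momentM ν p.2)) := by
  have hi := hν.integrable (by norm_num)
  set B := (n : ℝ≥0∞) ^ (-1 / 2 : ℝ) * (momentM ν p.1 * momentM ν p.2) with hB
  set φ : (Fin d → ℝ) → ℝ := fun v => (v p.1 - mean ν p.1) * (v p.2 - mean ν p.2) with hφ
  have mφ : Measurable φ := by fun_prop
  set a : Sample n d → ℝ := fun x => sampleMean x p.1 - mean ν p.1 with ha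
  set b : Sample n d → ℝ := fun x => sampleMean x p.2 - mean ν p.2 with hb
  have mr := measurable_residual (n := n) (d := d)
  have ma : Measurable a := (measurable_sampleMean _).sub_const _
  have mb : Measurable b := (measurable_sampleMean _).sub_const _
  set D : Fin n → Sample n d → ℝ := fun j x =>
    a x * residual x j p.2 + b x * (x j p.1 - mean ν p.1) with hD
  have mD : ∀ j, Measurable (D j) := fun j => by fun_prop
  have e : (fun x : Sample n d => momentGap₂ ν (residual x) p) = fun x =>
      (n : ℝ)⁻¹ * ∑ j, D j x
        - ((n : ℝ)⁻¹ * ∑ j, φ (x j) - ∫ v, φ v ∂(ν : Measure (Fin d → ℝ))) := by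
    funext x
    rw [sub_sub_eq_add_sub, add_comm, add_sub_assoc, ← mul_sub, ← Finset.sum_sub_distrib,
      momentGap₂, sub_eq_add_neg, ← mul_neg, ← Finset.sum_neg_distrib]
    congr 2
    refine Finset.sum_congr rfl fun j _ => ?_
    simp only [hD, hφ, ha, hb, residual, Pi.sub_apply]
    ring
  have hDn : ∀ j, eLpNorm (D j) (3 / 2) (iidLaw n ν) ≤ 2 * B := fun j => by
    refine (eLpNorm_add_le (f := fun x => a x * residual x j p.2)
      (g := fun x => b x * (x j p.1 - mean ν p.1)) (by fun_prop) (by fun_prop)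
      one_le_three_halves).trans ?_
    rw [two_mul]
    refine add_le_add ?_ ?_
    · refine (eLpNorm_mul_le_three_halves ma (mr j _) (eLpNorm_sampleMean_sub_mean_le hν p.1)
        ((eLpNorm_le_eLpNorm_of_exponent_le (q := 12) (by norm_num)
          (mr j _).aestronglyMeasurable).trans (eLpNorm_residual_le j p.2))).trans_eq ?_
      rw [hB]; ring
    · refine (eLpNorm_mul_le_three_halves mb (by fun_prop)
        (eLpNorm_sampleMean_sub_mean_le hν p.2)
        ((eLpNorm_le_eLpNorm_of_exponent_le (q := 12) (by norm_num)
          (Measurable.aestronglyMeasurable (by fun_prop))).trans (eLpNorm_sample_sub_mean_le hi j p.1))).trans_eq ?_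
      rw [hB]; ring
  have hφ2 : eLpNorm φ 2 (ν : Measure (Fin d → ℝ)) ≤ momentM ν p.1 * momentM ν p.2 :=
    (eLpNorm_le_eLpNorm_of_exponent_le (q := 6) (by norm_num) mφ.aestronglyMeasurable).trans
      (eLpNorm_mul_le_six (by fun_prop) (by fun_prop) (eLpNorm_coord_sub_mean_le hi _)
        (eLpNorm_coord_sub_mean_le hi _))
  have hav := eLpNorm_average_sub_le (n := n) ν mφ
    (hφ2.trans_lt (ENNReal.mul_lt_top (momentM_ne_top hν _).lt_top
      (momentM_ne_top hν _).lt_top)).ne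
  rw [e]
  refine (eLpNorm_sub_le (Measurable.aestronglyMeasurable (by fun_prop))
    (Measurable.aestronglyMeasurable (by fun_prop)) one_le_three_halves).trans ?_
  calc _ ≤ 2 * B + B := add_le_add (eLpNorm_average_le mD one_le_three_halves hDn)
        ((eLpNorm_le_eLpNorm_of_exponent_le three_halves_le_two
          (Measurable.aestronglyMeasurable (by fun_prop))).trans
          (hav.trans (by rw [hB]; gcongr)))
    _ = 3 * B := by ring
    _ ≤ 4 * B := by gcongr; norm_num

/-- Three factors give three replacement terms, and the fluctuation of the average gives the fourth;
hence the constant 4. -/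
lemma eLpNorm_momentGap₃_le [NeZero n]
    (hν : MemLp (fun v => v) 12 (ν : Measure (Fin d → ℝ))) (q : Fin d × Fin d × Fin d) :
    eLpNorm (fun x : Sample n d => momentGap₃ ν (residual x) q) (3 / 2) (iidLaw n ν)
      ≤ 4 * ((n : ℝ≥0∞) ^ (-1 / 2 : ℝ) *
        (momentM ν q.1 * (momentM ν q.2.1 * momentM ν q.2.2))) := by
  have hi := hν.integrable (by norm_num)
  set B := (n : ℝ≥0∞) ^ (-1 / 2 : ℝ) *
    (momentM ν q.1 * (momentM ν q.2.1 * momentM ν q.2.2)) with hB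
  set φ : (Fin d → ℝ) → ℝ := fun v =>
    (v q.1 - mean ν q.1) * ((v q.2.1 - mean ν q.2.1) * (v q.2.2 - mean ν q.2.2)) with hφ
  have mφ : Measurable φ := by fun_prop
  set a : Sample n d → ℝ := fun x => sampleMean x q.1 - mean ν q.1 with ha
  set b : Sample n d → ℝ := fun x => sampleMean x q.2.1 - mean ν q.2.1 with hb
  set c : Sample n d → ℝ := fun x => sampleMean x q.2.2 - mean ν q.2.2 with hc
  have mr := measurable_residual (n := n) (d := d)
  have ma : Measurable a := (measurable_sampleMean _).sub_const _
  have mb : Measurable b := (measurable_sampleMean _).sub_const _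
  have mc : Measurable c := (measurable_sampleMean _).sub_const _
  set D : Fin n → Sample n d → ℝ := fun j x =>
    a x * (residual x j q.2.1 * residual x j q.2.2)
      + b x * ((x j q.1 - mean ν q.1) * residual x j q.2.2)
      + c x * ((x j q.1 - mean ν q.1) * (x j q.2.1 - mean ν q.2.1)) with hD
  have mD : ∀ j, Measurable (D j) := fun j => by fun_prop
  have e : (fun x : Sample n d => momentGap₃ ν (residual x) q) = fun x =>
      (n : ℝ)⁻¹ * ∑ j, D j x
        - ((n : ℝ)⁻¹ * ∑ j, φ (x j) - ∫ v, φ v ∂(ν : Measure (Fin d → ℝ))) := by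
    funext x
    rw [sub_sub_eq_add_sub, add_comm, add_sub_assoc, ← mul_sub, ← Finset.sum_sub_distrib,
      momentGap₃, sub_eq_add_neg, ← mul_neg, ← Finset.sum_neg_distrib]
    congr 2
    refine Finset.sum_congr rfl fun j _ => ?_
    simp only [hD, hφ, ha, hb, hc, residual, Pi.sub_apply]
    ring
  have hDn : ∀ j, eLpNorm (D j) (3 / 2) (iidLaw n ν) ≤ 3 * B := fun j => by
    have hr := fun k => eLpNorm_residual_le (ν := ν) j k
    have hs := fun k => eLpNorm_sample_sub_mean_le hi j k
    refine (eLpNorm_add_le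
      (f := fun x => a x * (residual x j q.2.1 * residual x j q.2.2)
        + b x * ((x j q.1 - mean ν q.1) * residual x j q.2.2))
      (g := fun x => c x * ((x j q.1 - mean ν q.1) * (x j q.2.1 - mean ν q.2.1)))
      (by fun_prop) (by fun_prop) one_le_three_halves).trans ?_
    calc _ ≤ (B + B) + B := add_le_add ((eLpNorm_add_le
            (f := fun x => a x * (residual x j q.2.1 * residual x j q.2.2))
            (g := fun x => b x * ((x j q.1 - mean ν q.1) * residual x j q.2.2))
            (by fun_prop) (by fun_prop) one_le_three_halves).trans (add_le_add ?_ ?_)) ?_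
      _ = 3 * B := by ring
    · refine (eLpNorm_mul_le_three_halves ma (by fun_prop) (eLpNorm_sampleMean_sub_mean_le hν _)
        (eLpNorm_mul_le_six (mr j _) (mr j _) (hr _) (hr _))).trans_eq ?_
      rw [hB]; ring
    · refine (eLpNorm_mul_le_three_halves mb (by fun_prop) (eLpNorm_sampleMean_sub_mean_le hν _)
        (eLpNorm_mul_le_six (by fun_prop) (mr j _) (hs _) (hr _))).trans_eq ?_
      rw [hB]; ring
    · refine (eLpNorm_mul_le_three_halves mc (by fun_prop) (eLpNorm_sampleMean_sub_mean_le hν _)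
        (eLpNorm_mul_le_six (by fun_prop) (by fun_prop) (hs _) (hs _))).trans_eq ?_
      rw [hB]; ring
  have hφ2 : eLpNorm φ 2 (ν : Measure (Fin d → ℝ))
      ≤ momentM ν q.1 * (momentM ν q.2.1 * momentM ν q.2.2) := by
    have hc := fun k => eLpNorm_coord_sub_mean_le hi k
    -- The fluctuation bound needs the triple product in L₂: 1/3 + 1/6 = 1/2, with the last two
    -- factors combined in L₆.
    refine (eLpNorm_mul_le_real (by fun_prop) (by fun_prop) 3 6 2 (by norm_num)).trans
      (mul_le_mul' ?_ (eLpNorm_mul_le_six (by fun_prop) (by fun_prop) (hc _) (hc _)))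
    exact (eLpNorm_le_eLpNorm_of_exponent_le (q := 12) (by norm_num)
      (Measurable.aestronglyMeasurable (by fun_prop))).trans (hc _)
  have hav := eLpNorm_average_sub_le (n := n) ν mφ
    (hφ2.trans_lt (ENNReal.mul_lt_top (momentM_ne_top hν _).lt_top
      (ENNReal.mul_lt_top (momentM_ne_top hν _).lt_top (momentM_ne_top hν _).lt_top))).ne
  rw [e]
  refine (eLpNorm_sub_le (Measurable.aestronglyMeasurable (by fun_prop))
    (Measurable.aestronglyMeasurable (by fun_prop)) one_le_three_halves).trans ?_
  calc _ ≤ 3 * B + B := add_le_add (eLpNorm_average_le mD one_le_three_halves hDn)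
        ((eLpNorm_le_eLpNorm_of_exponent_le three_halves_le_two
          (Measurable.aestronglyMeasurable (by fun_prop))).trans
          (hav.trans (by rw [hB]; gcongr)))
    _ = 4 * B := by ring

end Gaps

end RobustBootstrap

/-! ### Integrated error of one exchange step. -/

namespace RobustBootstrap

variable {n d : ℕ} {ν : ProbabilityMeasure (Fin d → ℝ)} {f : Sample n d → ℝ}

lemma partialD_shift (i : Fin n) (k : Fin d) (F : Sample n d → ℝ) (c : Fin d → ℝ) :
    partialD i k (fun s => F (shift s c)) = fun s => partialD i k F (shift s c) := by
  funext s
  have := fderiv_comp_add_right (𝕜 := ℝ) (f := F) (x := s) (fun _ : Fin n => c)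
  simp only [partialD]
  exact congrArg (fun L : Sample n d →L[ℝ] ℝ => L (Pi.single i (Pi.single k 1))) this

lemma centeredFun_eq (x : Sample n d) :
    centeredFun ν f x = fun s => f (shift s (mean ν - sampleMean x)) := rfl

/-- The shift by `mean ν - sampleMean` undoes the recentering of the fresh copies, recenters the
resampled entries at the population mean, and carries `sampleMean` to `mean ν`. It thus identifies
the points in the smoothness condition with the expansion points of the exchange argument. -/
lemma shift_interp (i : Fin n) (u : Fin d → ℝ)
    (ω : Sample n d × (Fin n → Fin n) × Sample n d) :
    shift (interp ν i (sampleMean ω.1 + u) ω) (mean ν - sampleMean ω.1)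
      = basePt ν i ω + atIndex i u := by
  rw [basePt, ← interpAt_add]
  funext j
  simp only [shift, interp, interpAt, recenteredCopy, resample, recenter]
  split_ifs <;> abel

lemma shift_interp_mean (i : Fin n) (ω : Sample n d × (Fin n → Fin n) × Sample n d) :
    shift (interp ν i (sampleMean ω.1) ω) (mean ν - sampleMean ω.1) = basePt ν i ω := by
  have := shift_interp (ν := ν) i 0 ω
  simpa [atIndex] using this

lemma momentM_mul_coef₁_le (i : Fin n) (k : Fin d) :
    momentM ν k * eLpNorm (fun ω => ‖coef₁ ν f i ω k‖ₑ) 12 (jointLaw n ν)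
      ≤ D1 ν (centeredFun ν f) k := by
  rw [D1, eLpNorm_enorm_eq]
  refine mul_le_mul' le_rfl (le_iSup_of_le i (le_of_eq ?_))
  congr 1
  funext ω
  simp only [centeredFun_eq, partialD_shift, coef₁, shift_interp_mean]

lemma momentM_mul_coef₂_le (i : Fin n) (p : Fin d × Fin d) :
    momentM ν p.1 * momentM ν p.2 *
        eLpNorm (fun ω => ‖coef₂ ν f i ω p‖ₑ) 12 (jointLaw n ν)
      ≤ D2 ν (centeredFun ν f) p.2 p.1 := by
  rw [D2, eLpNorm_enorm_eq, mul_comm (momentM ν p.1)]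
  refine mul_le_mul' le_rfl (le_iSup_of_le i (le_of_eq ?_))
  congr 1
  funext ω
  simp only [centeredFun_eq, partialD_shift, coef₂, shift_interp_mean]

/-- The Taylor segment from `basePt` in direction `devY` or `devZ` corresponds to the segment from
`sampleMean` to the recentered copy or to the resampled vector, because differences are unaffected
by the shift. -/
lemma momentM_mul_coef₃_le (i : Fin n) (q : Fin d × Fin d × Fin d)
    {u : Sample n d × (Fin n → Fin n) × Sample n d → Fin d → ℝ}
    (hu : u = devY ν i ∨ u = devZ i) :
    momentM ν q.1 * momentM ν q.2.1 * momentM ν q.2.2 *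
        eLpNorm (fun ω => coef₃ ν f i ω (u ω) q) 12 (jointLaw n ν)
      ≤ D3 ν (centeredFun ν f) q.2.2 q.2.1 q.1 := by
  rw [D3, show momentM ν q.1 * momentM ν q.2.1 * momentM ν q.2.2
    = momentM ν q.2.2 * momentM ν q.2.1 * momentM ν q.1 by ring]
  refine mul_le_mul' le_rfl (le_iSup_of_le i (eLpNorm_mono_enorm fun ω => ?_))
  simp only [enorm_eq_self, coef₃]
  refine iSup₂_le fun r hr => ?_
  refine le_iSup₂_of_le (sampleMean ω.1 + r • u ω) ?_ (le_of_eq ?_)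
  · rcases hu with rfl | rfl
    · refine Or.inl ?_
      rw [segment_eq_image']
      refine ⟨r, hr, ?_⟩
      simp only [recenteredCopy, shift, devY]
      congr 2
      abel
    · refine Or.inr ?_
      rw [segment_eq_image']
      exact ⟨r, hr, rfl⟩
  · have hs : r • atIndex i (u ω) = atIndex i (r • u ω) := by
      simp only [atIndex, ← Pi.single_smul]
    simp only [centeredFun_eq, partialD_shift, shift_interp, hs]

section Integration

variable [NeZero n]

lemma eLpNorm_devZ_le (i : Fin n) (k : Fin d) :
    eLpNorm (fun ω => ‖devZ i ω k‖ₑ) 12 (jointLaw n ν) ≤ momentM ν k := by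
  rw [eLpNorm_enorm_eq]
  exact_mod_cast eLpNorm_prod_le_of_slices (μ := iidLaw n ν) (κ := auxLaw n ν)
    (F := fun ω => devZ i ω k) ((measurable_pi_apply k).comp (continuous_devZ i).measurable)
    (k := 12) (by norm_num) (fun w => by
      exact_mod_cast eLpNorm_residual_le (ν := ν) (w.1 i) k)

lemma eLpNorm_devY_le (hν : Integrable (fun v => v) (ν : Measure (Fin d → ℝ))) (i : Fin n)
    (k : Fin d) :
    eLpNorm (fun ω => ‖devY ν i ω k‖ₑ) 12 (jointLaw n ν) ≤ momentM ν k := by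
  rw [eLpNorm_enorm_eq]
  have h : MeasurePreserving (fun ω : Sample n d × (Fin n → Fin n) × Sample n d => ω.2.2)
      (jointLaw n ν) (iidLaw n ν) :=
    (measurePreserving_snd (μ := indexLaw n) (ν := iidLaw n ν)).comp
      (measurePreserving_snd (μ := iidLaw n ν) (ν := (indexLaw n).prod (iidLaw n ν)))
  exact (eLpNorm_comp_measurePreserving (g := fun y : Sample n d => y i k - mean ν k)
    (Measurable.aestronglyMeasurable (by fun_prop)) h).trans_le
    (eLpNorm_sample_sub_mean_le hν i k)

lemma eLpNorm_comp_fst {g : Sample n d → ℝ} (hg : Measurable g) (p : ℝ≥0∞) :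
    eLpNorm (fun ω : Sample n d × (Fin n → Fin n) × Sample n d => ‖g ω.1‖ₑ) p (jointLaw n ν)
      = eLpNorm g p (iidLaw n ν) := by
  rw [eLpNorm_enorm_eq]
  exact eLpNorm_comp_measurePreserving hg.aestronglyMeasurable
    (measurePreserving_fst (μ := iidLaw n ν) (ν := (indexLaw n).prod (iidLaw n ν)))

lemma eLpNorm_fun_sum_le {Ω σ : Type*} [MeasurableSpace Ω] {μ : Measure Ω} (s : Finset σ)
    {F : σ → Ω → ℝ≥0∞} (hF : ∀ k, Measurable (F k)) {p : ℝ≥0∞} (hp : 1 ≤ p) {B : σ → ℝ≥0∞}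
    (h : ∀ k, eLpNorm (F k) p μ ≤ B k) :
    eLpNorm (fun ω => ∑ k ∈ s, F k ω) p μ ≤ ∑ k ∈ s, B k := by
  have e : (fun ω => ∑ k ∈ s, F k ω) = ∑ k ∈ s, F k := by funext ω; simp
  rw [e]
  exact (eLpNorm_sum_le (fun k _ => (hF k).aestronglyMeasurable) hp).trans
    (Finset.sum_le_sum fun k _ => h k)

/-- The coefficient `∑ D_k`. -/
noncomputable def total₁ (ν : ProbabilityMeasure (Fin d → ℝ)) (f : Sample n d → ℝ) : ℝ≥0∞ :=
  ∑ k, D1 ν (centeredFun ν f) k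

/-- The coefficient `∑ D_{k₁,k₂}`. -/
noncomputable def total₂ (ν : ProbabilityMeasure (Fin d → ℝ)) (f : Sample n d → ℝ) : ℝ≥0∞ :=
  ∑ p : Fin d × Fin d, D2 ν (centeredFun ν f) p.2 p.1

/-- The coefficient `∑ D_{k₁,k₂,k₃}`. -/
noncomputable def total₃ (ν : ProbabilityMeasure (Fin d → ℝ)) (f : Sample n d → ℝ) : ℝ≥0∞ :=
  ∑ q : Fin d × Fin d × Fin d, D3 ν (centeredFun ν f) q.2.2 q.2.1 q.1

/-- With every factor in L₁₂, the linear, quadratic and remainder terms consist of products of two,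
three and four factors, so they lie in L₆, L₄ and L₃. The cubes need exactly L₃; the lower powers
follow from monotonicity of norms on a probability space. -/
lemma lintegral_remAbs_le (hf : ContDiff ℝ 3 f) (i : Fin n)
    {u : Sample n d × (Fin n → Fin n) × Sample n d → Fin d → ℝ}
    (hu : u = devY ν i ∨ u = devZ i) (cu : Continuous u)
    (hM : ∀ k, eLpNorm (fun ω => ‖u ω k‖ₑ) 12 (jointLaw n ν) ≤ momentM ν k) :
    ∫⁻ ω, remAbs (linAbs (coef₁ ν f i ω) (u ω)) (quadAbs (coef₂ ν f i ω) (u ω))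
        (remBound ν f i ω (u ω)) ∂(jointLaw n ν)
      ≤ remAbs (total₁ ν f) (total₂ ν f) (total₃ ν f) := by
  have mu := cu.measurable
  have m1 := measurable_coef₁ ν hf i
  have m2 := measurable_coef₂ ν hf i
  have m3 := measurable_coef₃ ν hf i cu
  have mL := measurable_linAbs m1 mu
  have mQ := measurable_quadAbs m2 mu
  have mR := measurable_remBound ν hf i cu
  have uu : ∀ k l, eLpNorm (fun ω => ‖u ω k‖ₑ * ‖u ω l‖ₑ) 6 (jointLaw n ν)
      ≤ momentM ν k * momentM ν l := fun k l =>
    (eLpNorm_mul_le_ennreal (by fun_prop) (by fun_prop) 12 12 6 (by norm_num)).trans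
      (mul_le_mul' (hM k) (hM l))
  have hL : eLpNorm (fun ω => linAbs (coef₁ ν f i ω) (u ω)) 3 (jointLaw n ν) ≤ total₁ ν f := by
    refine (eLpNorm_le_eLpNorm_of_exponent_le (q := 6) (by norm_num)
      mL.aestronglyMeasurable).trans ?_
    refine eLpNorm_fun_sum_le _ (fun k => by fun_prop) (by norm_num) fun k => ?_
    exact (eLpNorm_mul_le_ennreal (by fun_prop) (by fun_prop) 12 12 6 (by norm_num)).trans
      ((mul_le_mul' (hM k) le_rfl).trans (momentM_mul_coef₁_le i k))
  have hQ : eLpNorm (fun ω => quadAbs (coef₂ ν f i ω) (u ω)) 3 (jointLaw n ν)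
      ≤ total₂ ν f := by
    refine (eLpNorm_le_eLpNorm_of_exponent_le (q := 4) (by norm_num)
      mQ.aestronglyMeasurable).trans ?_
    refine eLpNorm_fun_sum_le _ (fun k => by fun_prop) (by norm_num) fun p => ?_
    exact (eLpNorm_mul_le_ennreal (by fun_prop) (by fun_prop) 6 12 4 (by norm_num)).trans
      ((mul_le_mul' (uu _ _) le_rfl).trans (momentM_mul_coef₂_le i p))
  have hR : eLpNorm (fun ω => remBound ν f i ω (u ω)) 3 (jointLaw n ν) ≤ total₃ ν f := by
    refine eLpNorm_fun_sum_le _ (fun q => by have := m3 q; fun_prop) (by norm_num) fun q => ?_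
    refine (eLpNorm_mul_le_ennreal (by fun_prop) (m3 q) 4 12 3 (by norm_num)).trans
      (le_trans (mul_le_mul' ?_ le_rfl) (momentM_mul_coef₃_le i q hu))
    exact (eLpNorm_mul_le_ennreal (by fun_prop) (by fun_prop) 6 12 4 (by norm_num)).trans
      (mul_le_mul' (uu _ _) (hM _))
  have cube : ∀ {F : Sample n d × (Fin n → Fin n) × Sample n d → ℝ≥0∞} {B : ℝ≥0∞},
      eLpNorm F 3 (jointLaw n ν) ≤ B → ∫⁻ ω, F ω ^ 3 ∂(jointLaw n ν) ≤ B ^ 3 := fun h => by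
    rw [lintegral_pow_eq_eLpNorm _ three_ne_zero, Nat.cast_ofNat]
    exact pow_le_pow_left' h 3
  unfold remAbs
  rw [lintegral_add_right _ (by fun_prop), lintegral_add_right _ (by fun_prop),
    lintegral_add_right _ (by fun_prop), lintegral_add_right _ (by fun_prop)]
  refine add_le_add (add_le_add (add_le_add (add_le_add ?_ (cube hR)) (cube hL)) ?_) (cube hQ)
  · refine le_trans ?_ hR
    have := eLpNorm_one_eq_lintegral_enorm (μ := jointLaw n ν)
      (f := fun ω => remBound ν f i ω (u ω))
    simp only [enorm_eq_self] at this
    rw [← this]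
    exact eLpNorm_le_eLpNorm_of_exponent_le (by norm_num) mR.aestronglyMeasurable
  · rw [lintegral_pow_eq_eLpNorm _ two_ne_zero, Nat.cast_ofNat]
    exact pow_le_pow_left' ((eLpNorm_le_eLpNorm_of_exponent_le (by norm_num)
      mQ.aestronglyMeasurable).trans hQ) 2

lemma lintegral_mul_le_three {Ω : Type*} [MeasurableSpace Ω] {μ : Measure Ω} {f g : Ω → ℝ≥0∞}
    (hf : Measurable f) (hg : Measurable g) {A B : ℝ≥0∞} (hA : eLpNorm f 3 μ ≤ A)
    (hB : eLpNorm g (3 / 2) μ ≤ B) : ∫⁻ ω, f ω * g ω ∂μ ≤ A * B := by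
  have := eLpNorm_mul_le_ennreal (μ := μ) hf hg 3 (3 / 2) 1 (by norm_num)
  rw [eLpNorm_one_eq_lintegral_enorm] at this
  simp only [enorm_eq_self] at this
  exact this.trans (mul_le_mul' hA hB)

/-- The derivative coefficients, bounded in L₃, are paired with the moment gaps in L_{3/2}. The
factors `momentM` produced by the gaps recombine with the coefficient norms into `D1` and `D2`, and
the gaps contribute `4 * n ^ (-1/2)`. -/
lemma lintegral_stepErr_le (hν : MemLp (fun v => v) 12 (ν : Measure (Fin d → ℝ)))
    (hf : ContDiff ℝ 3 f) (i : Fin n) :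
    ∫⁻ ω, stepErr ν f i ω ∂(jointLaw n ν)
      ≤ 4 * (n : ℝ≥0∞) ^ (-1 / 2 : ℝ) *
          (total₂ ν f + total₁ ν f ^ 2 + total₁ ν f * total₂ ν f)
        + 2 * remAbs (total₁ ν f) (total₂ ν f) (total₃ ν f) := by
  have hi := hν.integrable (by norm_num)
  have m1 := measurable_coef₁ ν hf i
  have m2 := measurable_coef₂ ν hf i
  have mg₂ : ∀ p, Measurable fun ω : Sample n d × (Fin n → Fin n) × Sample n d =>
      momentGap₂ ν (residual ω.1) p := fun p => (measurable_momentGap₂ ν p).comp measurable_fst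
  have mg₃ : ∀ p, Measurable fun ω : Sample n d × (Fin n → Fin n) × Sample n d =>
      momentGap₃ ν (residual ω.1) p := fun p => (measurable_momentGap₃ ν p).comp measurable_fst
  have cY := continuous_devY ν i
  have cZ := continuous_devZ (d := d) i
  set s₁ := fun k => eLpNorm (fun ω => ‖coef₁ ν f i ω k‖ₑ) 12 (jointLaw n ν) with hs₁
  set s₂ := fun p => eLpNorm (fun ω => ‖coef₂ ν f i ω p‖ₑ) 12 (jointLaw n ν) with hs₂
  set c := (n : ℝ≥0∞) ^ (-1 / 2 : ℝ) with hc
  have hg₂ : ∀ p, eLpNorm (fun ω : Sample n d × (Fin n → Fin n) × Sample n d =>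
      ‖momentGap₂ ν (residual ω.1) p‖ₑ) (3 / 2) (jointLaw n ν)
      ≤ 4 * (c * (momentM ν p.1 * momentM ν p.2)) := fun p =>
    (eLpNorm_comp_fst (g := fun x => momentGap₂ ν (residual x) p)
      (measurable_momentGap₂ ν p) _).trans_le (eLpNorm_momentGap₂_le hν p)
  have hg₃ : ∀ q, eLpNorm (fun ω : Sample n d × (Fin n → Fin n) × Sample n d =>
      ‖momentGap₃ ν (residual ω.1) q‖ₑ) (3 / 2) (jointLaw n ν)
      ≤ 4 * (c * (momentM ν q.1 * (momentM ν q.2.1 * momentM ν q.2.2))) := fun q =>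
    (eLpNorm_comp_fst (g := fun x => momentGap₃ ν (residual x) q)
      (measurable_momentGap₃ ν q) _).trans_le (eLpNorm_momentGap₃_le hν q)
  have h12 : ∀ {F G : Sample n d × (Fin n → Fin n) × Sample n d → ℝ≥0∞}, Measurable F →
      Measurable G → eLpNorm (fun ω => F ω * G ω) 3 (jointLaw n ν)
        ≤ eLpNorm F 12 (jointLaw n ν) * eLpNorm G 12 (jointLaw n ν) := fun hF hG =>
    (eLpNorm_le_eLpNorm_of_exponent_le (q := 6) (by norm_num)
      (hF.mul hG).aestronglyMeasurable).trans
      (eLpNorm_mul_le_ennreal hF hG 12 12 6 (by norm_num))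
  have b₂ : ∀ p : Fin d × Fin d, ∫⁻ ω, (‖coef₂ ν f i ω p‖ₑ
      + ‖coef₁ ν f i ω p.1‖ₑ * ‖coef₁ ν f i ω p.2‖ₑ) * ‖momentGap₂ ν (residual ω.1) p‖ₑ
        ∂(jointLaw n ν)
      ≤ 4 * c * (D2 ν (centeredFun ν f) p.2 p.1
        + D1 ν (centeredFun ν f) p.1 * D1 ν (centeredFun ν f) p.2) := by
    intro p
    refine (lintegral_mul_le_three (A := s₂ p + s₁ p.1 * s₁ p.2) (by fun_prop) (by fun_prop)
      ((eLpNorm_add_le (Measurable.aestronglyMeasurable (by fun_prop))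
        (Measurable.aestronglyMeasurable (by fun_prop)) (by norm_num)).trans
        (add_le_add (eLpNorm_le_eLpNorm_of_exponent_le (by norm_num)
          (Measurable.aestronglyMeasurable (by fun_prop)))
          (h12 (by fun_prop) (by fun_prop)))) (hg₂ p)).trans ?_
    calc _ = 4 * c * ((momentM ν p.1 * momentM ν p.2 * s₂ p)
          + (momentM ν p.1 * s₁ p.1) * (momentM ν p.2 * s₁ p.2)) := by ring
      _ ≤ _ := mul_le_mul' le_rfl (add_le_add (momentM_mul_coef₂_le i p)
        (mul_le_mul' (momentM_mul_coef₁_le i p.1) (momentM_mul_coef₁_le i p.2)))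
  have b₃ : ∀ q : Fin d × Fin d × Fin d, ∫⁻ ω, ‖coef₁ ν f i ω q.1‖ₑ * ‖coef₂ ν f i ω q.2‖ₑ
        * ‖momentGap₃ ν (residual ω.1) q‖ₑ ∂(jointLaw n ν)
      ≤ 4 * c * (D1 ν (centeredFun ν f) q.1 * D2 ν (centeredFun ν f) q.2.2 q.2.1) := by
    intro q
    refine (lintegral_mul_le_three (A := s₁ q.1 * s₂ q.2) (by fun_prop) (by fun_prop)
      (h12 (by fun_prop) (by fun_prop)) (hg₃ q)).trans ?_
    calc _ = 4 * c * ((momentM ν q.1 * s₁ q.1)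
          * (momentM ν q.2.1 * momentM ν q.2.2 * s₂ q.2)) := by ring
      _ ≤ _ := mul_le_mul' le_rfl
        (mul_le_mul' (momentM_mul_coef₁_le i q.1) (momentM_mul_coef₂_le i q.2))
  have mY : Measurable fun ω => remAbs (linAbs (coef₁ ν f i ω) (devY ν i ω))
      (quadAbs (coef₂ ν f i ω) (devY ν i ω)) (remBound ν f i ω (devY ν i ω)) :=
    measurable_remAbs (measurable_linAbs m1 cY.measurable) (measurable_quadAbs m2 cY.measurable)
      (measurable_remBound ν hf i cY)
  have mZ : Measurable fun ω => remAbs (linAbs (coef₁ ν f i ω) (devZ i ω))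
      (quadAbs (coef₂ ν f i ω) (devZ i ω)) (remBound ν f i ω (devZ i ω)) :=
    measurable_remAbs (measurable_linAbs m1 cZ.measurable) (measurable_quadAbs m2 cZ.measurable)
      (measurable_remBound ν hf i cZ)
  unfold stepErr stepBound
  have mYZ := mY.add mZ
  simp only [Pi.add_def] at mYZ
  rw [lintegral_add_right _ mYZ, lintegral_add_right _ mZ,
    lintegral_add_left (by fun_prop), lintegral_finsetSum _ (fun p _ => by fun_prop),
    lintegral_finsetSum _ (fun p _ => by fun_prop)]
  refine add_le_add ?_ ?_
  · refine (add_le_add (Finset.sum_le_sum fun p _ => b₂ p)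
      (Finset.sum_le_sum fun q _ => b₃ q)).trans_eq ?_
    rw [← Finset.mul_sum, ← Finset.mul_sum, ← mul_add, Finset.sum_add_distrib, pow_two]
    congr 2
    · congr 1
      rw [total₁, Finset.sum_mul_sum, Fintype.sum_prod_type]
    · rw [total₁, total₂, Finset.sum_mul_sum, Fintype.sum_prod_type]
  · rw [two_mul]
    exact add_le_add
      (lintegral_remAbs_le hf i (Or.inl rfl) cY (eLpNorm_devY_le hi i))
      (lintegral_remAbs_le hf i (Or.inr rfl) cZ (eLpNorm_devZ_le i))

end Integration

end RobustBootstrap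

/-! ### Summation over all steps, and smooth surrogates for tail events. -/

namespace RobustBootstrap

variable {n d : ℕ} {ν : ProbabilityMeasure (Fin d → ℝ)} {f : Sample n d → ℝ}

lemma Rc1_eq : Rc1 ν f = (n : ℝ≥0∞) ^ (1 / 3 : ℝ) * total₁ ν f := rfl

lemma Rc2_eq : Rc2 ν f = (n : ℝ≥0∞) ^ (1 / 2 : ℝ) * total₂ ν f := by
  rw [Rc2, total₂, Fintype.sum_prod_type, Finset.sum_comm]

lemma Rc3_eq : Rc3 ν f = (n : ℝ≥0∞) * total₃ ν f := by
  rw [Rc3, total₃, Fintype.sum_prod_type]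
  simp only [Fintype.sum_prod_type]
  congr 1
  calc _ = ∑ k₂, ∑ k₃, ∑ k₁, D3 ν (centeredFun ν f) k₁ k₂ k₃ := by
        rw [Finset.sum_comm]
        exact Finset.sum_congr rfl fun k₂ _ => Finset.sum_comm
    _ = ∑ k₃, ∑ k₂, ∑ k₁, D3 ν (centeredFun ν f) k₁ k₂ k₃ := Finset.sum_comm

/-- Each of the three gap terms and five remainder terms, multiplied by `N`, is at most `r`, so 22 =
4 · 3 + 2 · 5. The tightest cases are `N * a ^ 3`, `N * b ^ 2`, `N * c` and the gap term in `b`; for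
`a ^ 2` there is room because 1/2 ≤ 2/3. The condition `r ≤ 1` lets powers of `r` be replaced by
`r`. -/
lemma rate_le {N r a b c : ℝ≥0∞} (hN : 1 ≤ N) (hNt : N ≠ ⊤) (hr : r ≤ 1)
    (ha : N ^ (1 / 3 : ℝ) * a ≤ r) (hb : N ^ (1 / 2 : ℝ) * b ≤ r) (hc : N * c ≤ r) :
    N * (4 * N ^ (-1 / 2 : ℝ) * (b + a ^ 2 + a * b) + 2 * remAbs a b c) ≤ 22 * r := by
  have hN0 : N ≠ 0 := (zero_lt_one.trans_le hN).ne'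
  have pw : ∀ {x : ℝ≥0∞} {k : ℕ}, k ≠ 0 → x ≤ r → x ^ k ≤ r := fun {x k} hk hx =>
    (pow_le_pow_left' hx k).trans (pow_le_of_le_one zero_le hr hk)
  have e1 : N * N ^ (-1 / 2 : ℝ) = N ^ (1 / 2 : ℝ) := by
    nth_rewrite 1 [← ENNReal.rpow_one N]
    rw [← ENNReal.rpow_add _ _ hN0 hNt]; norm_num
  have e2 : (N ^ (1 / 2 : ℝ)) ^ 2 = N := by
    rw [← ENNReal.rpow_natCast, ← ENNReal.rpow_mul]; norm_num
  have e3 : (N ^ (1 / 3 : ℝ)) ^ 3 = N := by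
    rw [← ENNReal.rpow_natCast, ← ENNReal.rpow_mul]; norm_num
  have le32 : N ^ (1 / 2 : ℝ) ≤ (N ^ (1 / 3 : ℝ)) ^ 2 := by
    rw [← ENNReal.rpow_natCast, ← ENNReal.rpow_mul]
    exact ENNReal.rpow_le_rpow_of_exponent_le hN (by norm_num)
  have one3 : 1 ≤ N ^ (1 / 3 : ℝ) := ENNReal.one_le_rpow hN (by norm_num)
  have one2 : 1 ≤ N ^ (1 / 2 : ℝ) := ENNReal.one_le_rpow hN (by norm_num)
  have b' : b ≤ r := (le_mul_of_one_le_left zero_le one2).trans hb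
  have c' : c ≤ r := (le_mul_of_one_le_left zero_le hN).trans hc
  have t2 : N ^ (1 / 2 : ℝ) * a ^ 2 ≤ r :=
    (mul_le_mul' le32 le_rfl).trans (by rw [← mul_pow]; exact pw two_ne_zero ha)
  have t3 : N ^ (1 / 2 : ℝ) * (a * b) ≤ r := by
    calc _ = a * (N ^ (1 / 2 : ℝ) * b) := by ring
      _ ≤ 1 * r := mul_le_mul'
        ((le_mul_of_one_le_left zero_le one3).trans (ha.trans hr)) hb
      _ = r := one_mul r
  have t4 : N * a ^ 3 ≤ r := by
    nth_rewrite 1 [← e3]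
    rw [← mul_pow]; exact pw three_ne_zero ha
  have t5 : N * b ^ 2 ≤ r := by
    nth_rewrite 1 [← e2]
    rw [← mul_pow]; exact pw two_ne_zero hb
  have t6 : N * b ^ 3 ≤ r := by
    calc _ = (N * b ^ 2) * b := by ring
      _ ≤ r * 1 := mul_le_mul' t5 (b'.trans hr)
      _ = r := mul_one r
  have t7 : N * c ^ 3 ≤ r := by
    calc _ = (N * c) * c ^ 2 := by ring
      _ ≤ r * 1 := mul_le_mul' hc ((pw two_ne_zero c').trans hr)
      _ = r := mul_one r
  calc _ = 4 * ((N * N ^ (-1 / 2 : ℝ)) * b + (N * N ^ (-1 / 2 : ℝ)) * a ^ 2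
        + (N * N ^ (-1 / 2 : ℝ)) * (a * b))
        + 2 * (N * c + N * c ^ 3 + N * a ^ 3 + N * b ^ 2 + N * b ^ 3) := by
        unfold remAbs; ring
    _ ≤ 4 * (r + r + r) + 2 * (r + r + r + r + r) := by
        rw [e1]
        gcongr
    _ = 22 * r := by ring

lemma lintegral_lindErr_le [NeZero n] (hν : MemLp (fun v => v) 12 (ν : Measure (Fin d → ℝ)))
    (hf : ContDiff ℝ 3 f) {r : ℝ≥0∞} (hr : r ≤ 1)
    (hR : max (Rc1 ν f) (max (Rc2 ν f) (Rc3 ν f)) ≤ r) :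
    ∫⁻ x, lindErr ν f x ∂(iidLaw n ν) ≤ 22 * r := by
  obtain ⟨h1, h2, h3⟩ : Rc1 ν f ≤ r ∧ Rc2 ν f ≤ r ∧ Rc3 ν f ≤ r := by simpa using hR
  rw [Rc1_eq] at h1
  rw [Rc2_eq] at h2
  rw [Rc3_eq] at h3
  refine le_trans ?_ (rate_le (by exact_mod_cast NeZero.one_le) (by simp) hr h1 h2 h3)
  unfold lindErr
  rw [lintegral_finsetSum _ fun i _ => (measurable_stepErr ν hf i).lintegral_prod_right']
  calc _ ≤ ∑ _i : Fin n, _ := Finset.sum_le_sum fun i _ => by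
        refine le_trans (le_of_eq ?_) (lintegral_stepErr_le hν hf i)
        -- `jointLaw` unfolds to `iidLaw.prod auxLaw`, so averaging the conditional error over the
        -- data is Tonelli's theorem.
        exact (lintegral_prod (μ := iidLaw n ν) (ν := auxLaw n ν) (stepErr ν f i)
          (measurable_stepErr ν hf i).aemeasurable).symm
    _ = _ := by rw [Finset.sum_const, Finset.card_univ, Fintype.card_fin, nsmul_eq_mul]

/-- There is a smooth transition from `0` to `1` with bounded derivatives. -/
lemma exists_smooth_step : ∃ (S S₁ S₂ S₃ : ℝ → ℝ) (C : ℝ), TestFun S S₁ S₂ S₃ C ∧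
    (∀ r ≤ 0, S r = 0) ∧ (∀ r, 1 ≤ r → S r = 1) ∧ (∀ r, 0 ≤ S r) ∧ ∀ r, S r ≤ 1 := by
  have hS : ContDiff ℝ 3 Real.smoothTransition := Real.smoothTransition.contDiff
  have h1 : ContDiff ℝ 2 (deriv Real.smoothTransition) :=
    (contDiff_succ_iff_deriv (n := 2)).1 (by norm_num; exact hS) |>.2.2
  have h2 : ContDiff ℝ 1 (deriv (deriv Real.smoothTransition)) :=
    (contDiff_succ_iff_deriv (n := 1)).1 (by norm_num; exact h1) |>.2.2
  have h3 : Continuous (deriv (deriv (deriv Real.smoothTransition))) :=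
    h2.continuous_deriv (by norm_num)
  have c1 : HasCompactSupport (deriv Real.smoothTransition) := by
    refine HasCompactSupport.intro (isCompact_Icc (a := (0 : ℝ)) (b := 1)) fun x hx => ?_
    rw [Set.mem_Icc, not_and_or, not_le, not_le] at hx
    rcases hx with hx | hx
    · have : Real.smoothTransition =ᶠ[𝓝 x] fun _ => 0 := by
        filter_upwards [eventually_lt_nhds hx] with y hy
        exact Real.smoothTransition.zero_of_nonpos hy.le
      rw [this.deriv_eq, deriv_const]
    · have : Real.smoothTransition =ᶠ[𝓝 x] fun _ => 1 := by
        filter_upwards [eventually_gt_nhds hx] with y hy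
        exact Real.smoothTransition.one_of_one_le hy.le
      rw [this.deriv_eq, deriv_const]
  obtain ⟨C₁, hC₁⟩ := h1.continuous.bounded_above_of_compact_support c1
  obtain ⟨C₂, hC₂⟩ := h2.continuous.bounded_above_of_compact_support c1.deriv
  obtain ⟨C₃, hC₃⟩ := h3.bounded_above_of_compact_support c1.deriv.deriv
  refine ⟨Real.smoothTransition, _, _, _, max C₁ (max C₂ C₃),
    ⟨fun r => ((hS.differentiable (by norm_num)) r).hasDerivAt,
      fun r => ((h1.differentiable (by norm_num)) r).hasDerivAt,
      fun r => ((h2.differentiable (by norm_num)) r).hasDerivAt,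
      fun r => (hC₁ r).trans (le_max_left _ _),
      fun r => (hC₂ r).trans ((le_max_left _ _).trans (le_max_right _ _)),
      fun r => (hC₃ r).trans ((le_max_right _ _).trans (le_max_right _ _))⟩,
    fun r hr => Real.smoothTransition.zero_of_nonpos hr,
    fun r hr => Real.smoothTransition.one_of_one_le hr,
    fun r => Real.smoothTransition.nonneg r, fun r => Real.smoothTransition.le_one r⟩

/-- A smooth surrogate for the event `s ≤ |r - b|`, with derivative bounds that depend only on the
width `η` of the transition. -/
lemma exists_smooth_tail {η : ℝ} (hη : 0 < η) : ∃ C : ℝ, ∀ b s : ℝ, 0 < s →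
    ∃ h h₁ h₂ h₃ : ℝ → ℝ, TestFun h h₁ h₂ h₃ C ∧ (∀ r, 0 ≤ h r) ∧ (∀ r, h r ≤ 1) ∧
      (∀ r, s + η ≤ |r - b| → h r = 1) ∧ ∀ r, |r - b| < s → h r = 0 := by
  obtain ⟨S, S₁, S₂, S₃, C, H, h0, h1, hn, hl⟩ := exists_smooth_step
  -- The surrogate is a right and a left smooth step, placed at `b + s` and `b - s`. Since `s > 0`,
  -- at most one of them is nonzero at each point, so the sum stays below 1.
  refine ⟨_, fun b s hs => ⟨_, _, _, _, (H.comp_affine η⁻¹ (η⁻¹ * (-b - s))).add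
    (H.comp_affine (-η⁻¹) (η⁻¹ * (b - s))), fun r => add_nonneg (hn _) (hn _), ?_, ?_, ?_⟩⟩
  · intro r
    simp only [Pi.add_apply]
    rcases le_total r b with h | h
    · rw [h0 (η⁻¹ * r + η⁻¹ * (-b - s)), zero_add]
      · exact hl _
      · rw [← mul_add]
        exact mul_nonpos_of_nonneg_of_nonpos (by positivity) (by linarith)
    · rw [h0 (-η⁻¹ * r + η⁻¹ * (b - s)), add_zero]
      · exact hl _
      · rw [neg_mul, ← mul_neg, ← mul_add]
        exact mul_nonpos_of_nonneg_of_nonpos (by positivity) (by linarith)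
  · intro r hr
    simp only [Pi.add_apply]
    rcases le_total r b with h | h
    · rw [abs_of_nonpos (by linarith)] at hr
      rw [h0 (η⁻¹ * r + η⁻¹ * (-b - s)), zero_add, h1]
      · rw [neg_mul, ← mul_neg, ← mul_add, ← div_eq_inv_mul, le_div_iff₀ hη]
        linarith
      · rw [← mul_add]
        exact mul_nonpos_of_nonneg_of_nonpos (by positivity) (by linarith)
    · rw [abs_of_nonneg (by linarith)] at hr
      rw [h0 (-η⁻¹ * r + η⁻¹ * (b - s)), add_zero, h1]
      · rw [← mul_add, ← div_eq_inv_mul, le_div_iff₀ hη]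
        linarith
      · rw [neg_mul, ← mul_neg, ← mul_add]
        exact mul_nonpos_of_nonneg_of_nonpos (by positivity) (by linarith)
  · intro r hr
    simp only [Pi.add_apply]
    rw [abs_lt] at hr
    rw [h0, h0, add_zero]
    · rw [neg_mul, ← mul_neg, ← mul_add]
      exact mul_nonpos_of_nonneg_of_nonpos (by positivity) (by linarith)
    · rw [← mul_add]
      exact mul_nonpos_of_nonneg_of_nonpos (by positivity) (by linarith)

end RobustBootstrap

/-! ### From the conditional comparison to the miss probability. -/

namespace RobustBootstrap

variable {n d : ℕ} {ν : ProbabilityMeasure (Fin d → ℝ)} {f g : Sample n d → ℝ}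

lemma measurePreserving_aux_index : MeasurePreserving
    (fun ω : (Fin n → Fin n) × Sample n d => ω.1) (auxLaw n ν) (indexLaw n) :=
  measurePreserving_fst

lemma measurePreserving_aux_copy [NeZero n] : MeasurePreserving
    (fun ω : (Fin n → Fin n) × Sample n d => ω.2) (auxLaw n ν) (iidLaw n ν) :=
  measurePreserving_snd

/-- The conditional `L₁` distance of two statistics on the recentered bootstrap sample. -/
noncomputable def bootDist (ν : ProbabilityMeasure (Fin d → ℝ)) (f g : Sample n d → ℝ)
    (x : Sample n d) : ℝ≥0∞ :=
  ∫⁻ ω : (Fin n → Fin n) × Sample n d, ‖f (centeredResample (mean ν) x ω.1)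
    - g (centeredResample (mean ν) x ω.1)‖ₑ ∂(auxLaw n ν)

lemma integrable_index [NeZero n] (φ : (Fin n → Fin n) → ℝ) :
    Integrable (fun ω : (Fin n → Fin n) × Sample n d => φ ω.1) (auxLaw n ν) :=
  measurePreserving_aux_index.integrable_comp_of_integrable (g := φ) Integrable.of_finite

/-- A smooth statistic is integrable as soon as the exchange error is finite for some data. -/
lemma integrable_of_lindErr [NeZero n] (hν : Integrable (fun v => v) (ν : Measure (Fin d → ℝ)))
    (hf : ContDiff ℝ 3 f) {x : Sample n d} (hx : lindErr ν f x ≠ ⊤) :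
    Integrable f (iidLaw n ν) := by
  have h1 := (lindeberg_conditional ν hν hf hx TestFun.id).1.add
    (integrable_index (ν := ν) fun J => f (centeredResample (mean ν) x J))
  refine (measurePreserving_aux_copy.integrable_comp hf.continuous.aestronglyMeasurable).1
    (h1.congr (.of_forall fun ω => ?_))
  simp

lemma integrable_of_dist (hf : Integrable f (iidLaw n ν)) (hg : Measurable g)
    (h : ∫⁻ y, ‖f y - g y‖ₑ ∂(iidLaw n ν) ≠ ⊤) : Integrable g (iidLaw n ν) := by
  have : Integrable (fun y => f y - g y) (iidLaw n ν) :=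
    ⟨hf.1.sub hg.aestronglyMeasurable, h.lt_top⟩
  exact (hf.sub this).congr (.of_forall fun y => by simp)

/-- The conditional bootstrap mean is close to the true mean. -/
lemma enorm_mean_sub_le [NeZero n] (hν : Integrable (fun v => v) (ν : Measure (Fin d → ℝ)))
    (hf : ContDiff ℝ 3 f) (hg : Measurable g) {x : Sample n d} (hx : lindErr ν f x ≠ ⊤)
    (h : ∫⁻ y, ‖f y - g y‖ₑ ∂(iidLaw n ν) ≠ ⊤) :
    ‖(∫ y, g y ∂(iidLaw n ν)) - ∫ J, g (centeredResample (mean ν) x J) ∂(indexLaw n)‖ₑ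
      ≤ (∫⁻ y, ‖f y - g y‖ₑ ∂(iidLaw n ν)) + 20 * lindErr ν f x + bootDist ν f g x := by
  have intf := integrable_of_lindErr hν hf hx
  have intg := integrable_of_dist intf hg h
  have hL := lindeberg_conditional ν hν hf hx TestFun.id
  have e1 : ∫ ω, f ω.2 ∂(auxLaw n ν) = ∫ y, f y ∂(iidLaw n ν) := by
    rw [← (measurePreserving_aux_copy (ν := ν)).map_eq,
      integral_map measurable_snd.aemeasurable hf.continuous.aestronglyMeasurable]
  have e2 : ∀ φ : Sample n d → ℝ, ∫ ω, φ (centeredResample (mean ν) x ω.1) ∂(auxLaw n ν)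
      = ∫ J, φ (centeredResample (mean ν) x J) ∂(indexLaw n) := fun φ => by
    rw [← (measurePreserving_aux_index (ν := ν)).map_eq,
      integral_map measurable_fst.aemeasurable
        (measurable_of_finite fun J => φ (centeredResample (mean ν) x J)).aestronglyMeasurable]
  have i1 := measurePreserving_aux_copy.integrable_comp_of_integrable intf
  have i2 := fun φ : Sample n d → ℝ =>
    integrable_index (ν := ν) fun J => φ (centeredResample (mean ν) x J)
  rw [← e2 g]
  -- The route from fresh `g` to bootstrap `g` passes through fresh `f` and bootstrap `f`. The
  -- middle difference is the exchange error for the identity, whose derivative bound 1 yields the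
  -- factor 20.
  have key : (∫ y, g y ∂(iidLaw n ν)) - ∫ ω, g (centeredResample (mean ν) x ω.1) ∂(auxLaw n ν)
      = -(∫ y, (f y - g y) ∂(iidLaw n ν))
        + (∫ ω, (f ω.2 - f (centeredResample (mean ν) x ω.1)) ∂(auxLaw n ν))
        + ∫ ω, (f (centeredResample (mean ν) x ω.1) - g (centeredResample (mean ν) x ω.1))
          ∂(auxLaw n ν) := by
    rw [integral_sub intf intg, integral_sub (f := fun ω => f ω.2) i1 (i2 f),
      integral_sub (i2 f) (i2 g), e1]
    ring
  rw [key]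
  refine (enorm_add_le _ _).trans (add_le_add ((enorm_add_le _ _).trans (add_le_add ?_ ?_))
    (enorm_integral_le_lintegral_enorm _))
  · rw [enorm_neg]
    exact enorm_integral_le_lintegral_enorm _
  · refine hL.2.trans_eq ?_
    norm_num

/-- Markov's inequality, used to convert the L₁ distance of `f` and `g` into a small probability. -/
lemma meas_enorm_ge_le {Ω : Type*} [MeasurableSpace Ω] {μ : Measure Ω} {F : Ω → ℝ}
    (hF : Measurable F) {η : ℝ} (hη : 0 < η) :
    μ {ω | η ≤ |F ω|} ≤ ENNReal.ofReal η⁻¹ * ∫⁻ ω, ‖F ω‖ₑ ∂μ := by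
  have e : {ω | η ≤ |F ω|} = {ω | ENNReal.ofReal η ≤ ‖F ω‖ₑ} := by
    ext ω
    rw [Set.mem_ofPred_eq, Set.mem_ofPred_eq, Real.enorm_eq_ofReal_abs,
      ENNReal.ofReal_le_ofReal_iff (abs_nonneg _)]
  rw [e, ENNReal.ofReal_inv_of_pos hη, mul_comm, ← div_eq_mul_inv]
  exact meas_ge_le_lintegral_div hF.enorm.aemeasurable (by simpa using hη) ENNReal.ofReal_ne_top

/-- Given the data, the miss probability is controlled by the nominal level. -/
lemma exists_conditional_miss_le {δ : ℝ} (hδ : 0 < δ) : ∃ C : ℝ≥0∞, C ≠ ⊤ ∧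
    ∀ {n d : ℕ} [NeZero n] {ν : ProbabilityMeasure (Fin d → ℝ)} {f g : Sample n d → ℝ}
      (_ : Integrable (fun v => v) (ν : Measure (Fin d → ℝ))) (_ : ContDiff ℝ 3 f)
      (_ : Measurable g) {x : Sample n d} (_ : lindErr ν f x ≠ ⊤)
      (_ : ∫⁻ y, ‖f y - g y‖ₑ ∂(iidLaw n ν) ≠ ⊤) {s : ℝ} {p : ℝ≥0∞}
      (_ : bootTail g (mean ν) x s ≤ p),
    iidLaw n ν {y | |g y - ∫ y', g y' ∂(iidLaw n ν)| ≥ s + δ}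
      ≤ p + C * ((∫⁻ y, ‖f y - g y‖ₑ ∂(iidLaw n ν)) + lindErr ν f x + bootDist ν f g x) := by
  -- The margin `δ` is spent in four quarters: `f` against `g` on the fresh sample, the true mean
  -- `a` against the bootstrap mean `b`, the width of the smooth transition, and `f` against `g` on
  -- the bootstrap sample.
  have hη : 0 < δ / 4 := by positivity
  obtain ⟨D, hD⟩ := exists_smooth_tail hη
  set c := ENNReal.ofReal (δ / 4)⁻¹ with hc
  refine ⟨c * 20 + ENNReal.ofReal (20 * D), ENNReal.add_ne_top.2
    ⟨ENNReal.mul_ne_top ENNReal.ofReal_ne_top (by simp), ENNReal.ofReal_ne_top⟩, ?_⟩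
  intro n d _ ν f g hν hf hg x hx hfin s p hp
  set e := ∫⁻ y, ‖f y - g y‖ₑ ∂(iidLaw n ν) with he
  set l := lindErr ν f x with hl
  set q := bootDist ν f g x with hq
  set a := ∫ y', g y' ∂(iidLaw n ν) with ha
  set b := ∫ J, g (centeredResample (mean ν) x J) ∂(indexLaw n) with hb
  set C := c * 20 + ENNReal.ofReal (20 * D) with hC
  have cC : c ≤ C := (le_mul_of_one_le_right zero_le (by norm_num)).trans le_self_add
  have hab : ‖a - b‖ₑ ≤ e + 20 * l + q := enorm_mean_sub_le hν hf hg hx hfin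
  have prob : ∀ A : Set (Sample n d), iidLaw n ν A ≤ 1 := fun A => prob_le_one
  -- A negative threshold makes the bootstrap tail event certain, so `p ≥ 1`. Afterwards `s + δ / 4`
  -- is positive, as the surrogate requires.
  rcases lt_or_ge s 0 with hs | hs
  · refine (prob _).trans (le_trans ?_ le_self_add)
    refine le_trans (le_of_eq ?_) hp
    rw [bootTail, ← measure_univ (μ := indexLaw n)]
    congr 1
    ext J
    simpa using hs.le.trans (abs_nonneg _)
  -- If the two means differ by at least `δ / 4`, the error term alone exceeds 1. This case accounts
  -- for the summand `c * 20` of the constant.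
  rcases le_or_gt (δ / 4) |a - b| with hd | hd
  · refine (prob _).trans (le_trans ?_ le_add_self)
    have h1 : (1 : ℝ≥0∞) ≤ c * ‖a - b‖ₑ := by
      rw [hc, Real.enorm_eq_ofReal_abs, ← ENNReal.ofReal_mul (by positivity),
        ENNReal.one_le_ofReal, ← div_eq_inv_mul]
      exact (one_le_div hη).2 hd
    calc (1 : ℝ≥0∞) ≤ c * (e + 20 * l + q) := h1.trans (mul_le_mul' le_rfl hab)
      _ ≤ c * (20 * e + 20 * l + 20 * q) := by
        gcongr
        · exact le_mul_of_one_le_left zero_le (by norm_num)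
        · exact le_mul_of_one_le_left zero_le (by norm_num)
      _ = c * 20 * (e + l + q) := by ring
      _ ≤ C * (e + l + q) := mul_le_mul' le_self_add le_rfl
  obtain ⟨h, h₁, h₂, h₃, H, hnn, hle, hone, hzero⟩ := hD b (s + δ / 4) (by linarith)
  obtain ⟨-, hint⟩ := lindeberg_conditional ν hν hf hx H
  set K := auxLaw n ν with hK
  set zb : (Fin n → Fin n) × Sample n d → Sample n d :=
    fun ω => centeredResample (mean ν) x ω.1 with hzb
  have mz : Measurable zb :=
    (measurable_of_finite fun J => centeredResample (mean ν) x J).comp measurable_fst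
  have mh : Measurable h := (Differentiable.continuous fun r => (H.d0 r).differentiableAt).measurable
  have mf : Measurable f := hf.continuous.measurable
  have bdd : ∀ {φ : (Fin n → Fin n) × Sample n d → ℝ}, Measurable φ →
      Integrable (fun ω => h (φ ω)) K := fun mφ =>
    Integrable.of_bound (mh.comp mφ).aestronglyMeasurable 1
      (.of_forall fun ω => by
        rw [Real.norm_eq_abs, abs_of_nonneg (hnn _)]; exact hle _)
  have iY : Integrable (fun ω : (Fin n → Fin n) × Sample n d => h (f ω.2)) K :=
    bdd (mf.comp measurable_snd)
  have iZ : Integrable (fun ω => h (f (zb ω))) K := bdd (mf.comp mz)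
  -- the fresh copy
  have u1 : iidLaw n ν {y | |g y - a| ≥ s + δ}
      ≤ c * e + ∫⁻ ω, ENNReal.ofReal (h (f ω.2)) ∂K := by
    have hsub : {y | |g y - a| ≥ s + δ}
        ⊆ {y | δ / 4 ≤ |f y - g y|} ∪ {y | s + δ / 4 + δ / 4 ≤ |f y - b|} := by
      intro y hy
      by_contra hcon
      simp only [Set.mem_union, Set.mem_ofPred_eq, not_or, not_le] at hcon
      have t1 : |g y - a| ≤ |f y - g y| + |f y - b| + |a - b| := by
        rw [show g y - a = -(f y - g y) + (f y - b) + -(a - b) by ring]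
        refine (abs_add_three _ _ _).trans_eq ?_
        rw [abs_neg, abs_neg]
      have hy' : s + δ ≤ |g y - a| := hy
      linarith [hcon.1, hcon.2]
    refine (measure_mono hsub).trans ((measure_union_le _ _).trans (add_le_add
      (meas_enorm_ge_le (mf.sub hg) hη) ?_))
    have mset : MeasurableSet {y | s + δ / 4 + δ / 4 ≤ |f y - b|} :=
      measurableSet_le measurable_const (mf.sub_const b).abs
    rw [← (measurePreserving_aux_copy (ν := ν)).measure_preimage mset.nullMeasurableSet,
      ← lintegral_indicator_one (measurable_snd mset)]
    refine lintegral_mono fun ω => ?_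
    by_cases hω : s + δ / 4 + δ / 4 ≤ |f ω.2 - b|
    · rw [Set.indicator_of_mem (by exact hω), hone _ hω]
      simp
    · rw [Set.indicator_of_notMem (by exact hω)]
      exact zero_le
  -- the bootstrap sample
  have u2 : ∫⁻ ω, ENNReal.ofReal (h (f (zb ω))) ∂K ≤ p + c * q := by
    have hsub : {ω | s + δ / 4 ≤ |f (zb ω) - b|}
        ⊆ {ω | s ≤ |g (zb ω) - b|} ∪ {ω | δ / 4 ≤ |f (zb ω) - g (zb ω)|} := by
      intro ω hω
      by_contra hcon
      simp only [Set.mem_union, Set.mem_ofPred_eq, not_or, not_le] at hcon hω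
      have t1 : |f (zb ω) - b| ≤ |f (zb ω) - g (zb ω)| + |g (zb ω) - b| := by
        rw [show f (zb ω) - b = (f (zb ω) - g (zb ω)) + (g (zb ω) - b) by ring]
        exact abs_add_le _ _
      linarith [hcon.1, hcon.2]
    have mset : MeasurableSet {ω | s + δ / 4 ≤ |f (zb ω) - b|} :=
      measurableSet_le measurable_const ((mf.comp mz).sub_const b).abs
    calc _ ≤ ∫⁻ ω, {ω | s + δ / 4 ≤ |f (zb ω) - b|}.indicator 1 ω ∂K := by
          refine lintegral_mono fun ω => ?_
          by_cases hω : s + δ / 4 ≤ |f (zb ω) - b|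
          · rw [Set.indicator_of_mem (by exact hω)]
            simpa using hle _
          · rw [Set.indicator_of_notMem (by exact hω), hzero _ (not_le.1 hω)]
            simp
      _ = K {ω | s + δ / 4 ≤ |f (zb ω) - b|} := lintegral_indicator_one mset
      _ ≤ K {ω | s ≤ |g (zb ω) - b|} + K {ω | δ / 4 ≤ |f (zb ω) - g (zb ω)|} :=
          (measure_mono hsub).trans (measure_union_le _ _)
      _ ≤ p + c * q := by
          refine add_le_add (le_trans (le_of_eq ?_) hp)
            (meas_enorm_ge_le ((mf.comp mz).sub (hg.comp mz)) hη)
          exact (measurePreserving_aux_index (ν := ν)).measure_preimage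
            (s := {J | |g (centeredResample (mean ν) x J) - b| ≥ s})
            (Set.toFinite _).measurableSet.nullMeasurableSet
  have u3 : ∫⁻ ω, ENNReal.ofReal (h (f ω.2)) ∂K
      ≤ ∫⁻ ω, ENNReal.ofReal (h (f (zb ω))) ∂K + ENNReal.ofReal (20 * D) * l := by
    rw [← ofReal_integral_eq_lintegral_ofReal iY (.of_forall fun _ => hnn _),
      ← ofReal_integral_eq_lintegral_ofReal iZ (.of_forall fun _ => hnn _)]
    refine le_trans ?_ (add_le_add le_rfl hint)
    rw [integral_sub iY iZ, Real.enorm_eq_ofReal_abs,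
      ← ENNReal.ofReal_add (integral_nonneg fun _ => hnn _) (abs_nonneg _)]
    refine ENNReal.ofReal_le_ofReal ?_
    linarith [le_abs_self ((∫ ω, h (f ω.2) ∂K) - ∫ ω, h (f (zb ω)) ∂K)]
  calc _ ≤ c * e + (p + c * q + ENNReal.ofReal (20 * D) * l) :=
        u1.trans (add_le_add le_rfl (u3.trans (add_le_add u2 le_rfl)))
    _ = p + (c * e + ENNReal.ofReal (20 * D) * l + c * q) := by ring
    _ ≤ p + (C * e + C * l + C * q) := by
        gcongr
        exact le_add_self
    _ = p + C * (e + l + q) := by ring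

lemma measurable_centeredResample (i : Fin n → Fin n) (c : Fin d → ℝ) :
    Measurable fun x : Sample n d => centeredResample c x i := by
  refine measurable_pi_iff.2 fun j => ?_
  have := (continuous_sampleMean (n := n) (d := d)).measurable
  simp only [centeredResample, shift, resample]
  fun_prop

lemma measurable_bootDist_integrand (hf : Measurable f) (hg : Measurable g) :
    Measurable fun ω : Sample n d × (Fin n → Fin n) × Sample n d =>
      ‖f (centeredResample (mean ν) ω.1 ω.2.1) - g (centeredResample (mean ν) ω.1 ω.2.1)‖ₑ := by
  have h : Measurable fun p : (Fin n → Fin n) × Sample n d =>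
      centeredResample (mean ν) p.2 p.1 :=
    measurable_from_prod_countable_right fun J => measurable_centeredResample J _
  have h' : Measurable fun ω : Sample n d × (Fin n → Fin n) × Sample n d =>
      centeredResample (mean ν) ω.1 ω.2.1 :=
    h.comp (g := fun p : (Fin n → Fin n) × Sample n d => centeredResample (mean ν) p.2 p.1)
      (f := fun ω : Sample n d × (Fin n → Fin n) × Sample n d => (ω.2.1, ω.1)) (by fun_prop)
  exact ((hf.comp h').sub (hg.comp h')).enorm

/-- The miss probability is controlled by the nominal level, the approximation error and the
smoothness coefficients. -/
lemma exists_missProb_le {δ : ℝ} (hδ : 0 < δ) : ∃ C : ℝ≥0∞, C ≠ ⊤ ∧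
    ∀ {n d : ℕ} [NeZero n] {ν : ProbabilityMeasure (Fin d → ℝ)} {f g t : Sample n d → ℝ}
      {p r e : ℝ≥0∞} (_ : MemLp (fun v => v) 12 (ν : Measure (Fin d → ℝ))) (_ : ContDiff ℝ 3 f)
      (_ : Measurable g) (_ : AEMeasurable t (iidLaw n ν))
      (_ : ∀ᵐ x ∂(iidLaw n ν), bootTail g (mean ν) x (t x) ≤ p)
      (_ : r ≤ 1) (_ : max (Rc1 ν f) (max (Rc2 ν f) (Rc3 ν f)) ≤ r) (_ : e ≠ ⊤)
      (_ : (∫⁻ ω, ‖f (centeredResample (mean ν) ω.1 ω.2.1)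
            - g (centeredResample (mean ν) ω.1 ω.2.1)‖ₑ ∂(jointLaw n ν))
        + ∫⁻ x, ‖f x - g x‖ₑ ∂(iidLaw n ν) ≤ e),
    Integrable g (iidLaw n ν) ∧ missProb ν g t δ ≤ p + C * (e + 22 * r) := by
  obtain ⟨C, hC, key⟩ := exists_conditional_miss_le hδ
  refine ⟨C, hC, ?_⟩
  intro n d _ ν f g t p r e hν hf hg ht hp hr hR hetop he
  have hi := hν.integrable (by norm_num)
  have mf : Measurable f := hf.continuous.measurable
  have hL := lintegral_lindErr_le hν hf hr hR
  have hLtop : ∫⁻ x, lindErr ν f x ∂(iidLaw n ν) ≠ ⊤ :=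
    (hL.trans_lt (ENNReal.mul_lt_top (by simp) (hr.trans_lt ENNReal.one_lt_top))).ne
  have hfin : ∀ᵐ x ∂(iidLaw n ν), lindErr ν f x < ⊤ :=
    ae_lt_top (measurable_lindErr ν hf) hLtop
  have hdist : ∫⁻ x, ‖f x - g x‖ₑ ∂(iidLaw n ν) ≠ ⊤ := ((le_add_self.trans he).trans_lt hetop.lt_top).ne
  refine ⟨?_, ?_⟩
  · obtain ⟨x, hx⟩ := hfin.exists
    exact integrable_of_dist (integrable_of_lindErr hi hf hx.ne) hg hdist
  set a := ∫ y, g y ∂(iidLaw n ν) with ha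
  -- `t` is only almost everywhere measurable; a measurable version is substituted before the
  -- product measure is sliced.
  have mset : MeasurableSet {q : Sample n d × Sample n d | |g q.2 - a| ≥ ht.mk t q.1 + δ} :=
    measurableSet_le ((ht.measurable_mk.comp measurable_fst).add_const δ)
      ((hg.comp measurable_snd).sub_const a).abs
  have hcongr : missProb ν g t δ
      = ((iidLaw n ν).prod (iidLaw n ν)) {q | |g q.2 - a| ≥ ht.mk t q.1 + δ} := by
    refine measure_congr ?_
    filter_upwards [Measure.quasiMeasurePreserving_fst.ae ht.ae_eq_mk] with q hq
    exact propext (by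
      change |g q.2 - a| ≥ t q.1 + δ ↔ |g q.2 - a| ≥ ht.mk t q.1 + δ
      rw [hq])
  have mboot := measurable_bootDist_integrand (ν := ν) mf hg
  have mq : Measurable (bootDist ν f g) := mboot.lintegral_prod_right'
  have hq : ∫⁻ x, bootDist ν f g x ∂(iidLaw n ν)
      = ∫⁻ ω, ‖f (centeredResample (mean ν) ω.1 ω.2.1)
            - g (centeredResample (mean ν) ω.1 ω.2.1)‖ₑ ∂(jointLaw n ν) :=
    (lintegral_prod (μ := iidLaw n ν) (ν := auxLaw n ν) _ mboot.aemeasurable).symm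
  have ml := measurable_lindErr ν hf
  rw [hcongr, Measure.prod_apply mset]
  calc _ ≤ ∫⁻ x, (p + C * ((∫⁻ y, ‖f y - g y‖ₑ ∂(iidLaw n ν)) + lindErr ν f x
          + bootDist ν f g x)) ∂(iidLaw n ν) := by
        refine lintegral_mono_ae ?_
        filter_upwards [hfin, hp, ht.ae_eq_mk] with x h1 h2 h3
        have := key hi hf hg h1.ne hdist h2
        rw [h3] at this
        exact this
    _ = p + C * ((∫⁻ y, ‖f y - g y‖ₑ ∂(iidLaw n ν)) + (∫⁻ x, lindErr ν f x ∂(iidLaw n ν))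
          + ∫⁻ x, bootDist ν f g x ∂(iidLaw n ν)) := by
        rw [lintegral_add_left (by fun_prop), lintegral_const_mul _ (by fun_prop),
          lintegral_add_left (by fun_prop), lintegral_add_left (by fun_prop)]
        simp
    _ ≤ p + C * (e + 22 * r) := by
        rw [hq, add_right_comm]
        gcongr
        rw [add_comm]
        exact he

end RobustBootstrap

/-! ### Passage to the limit, uniformly over the class of laws. -/

open RobustBootstrap
theorem mainTheorem8
    (d : ℕ → ℕ)
    (g f : ∀ n, Sample n (d n) → ℝ)
    (hg : ∀ n, Measurable (g n))
    (hf : ∀ n, ContDiff ℝ 3 (f n))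
    (P : ∀ n, Set (ProbabilityMeasure (Fin (d n) → ℝ)))
    (hP : ∀ n, ∀ ν ∈ P n, MemLp (fun x => x) 12 (ν : Measure (Fin (d n) → ℝ)))
    (happrox : UniformApprox d g f P)
    (hsmooth : UniformSmooth d f P)
    (A : ∀ n, Set (Fin (d n) → ℝ))
    (α : ℝ) (hα : 0 ≤ α)
    (t : ∀ n, Sample n (d n) → ℝ)
    (ht_meas : ∀ n, ∀ ν ∈ P n, AEMeasurable (t n) (iidLaw n ν))
    (ht : ∀ n, ∀ ν ∈ P n, ∀ᵐ x ∂(iidLaw n ν),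
      ⨆ μ ∈ A n, bootTail (g n) μ x (t n x) ≤ ENNReal.ofReal α) :
    (∀ᶠ n in atTop, ∀ ν ∈ {ν ∈ P n | mean ν ∈ A n}, Integrable (g n) (iidLaw n ν)) ∧
    liminf (fun δ : ℝ =>
        limsup (fun n => ⨆ ν ∈ {ν ∈ P n | mean ν ∈ A n}, missProb ν (g n) (t n) δ) atTop)
      (𝓝[>] 0) ≤ ENNReal.ofReal α := by
  unfold UniformApprox at happrox
  unfold UniformSmooth at hsmooth
  set e : ℕ → ℝ≥0∞ := fun n => ⨆ ν ∈ P n,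
      ((∫⁻ ω, ‖f n (centeredResample (mean ν) ω.1 ω.2.1)
            - g n (centeredResample (mean ν) ω.1 ω.2.1)‖ₑ ∂(jointLaw n ν))
        + ∫⁻ x, ‖f n x - g n x‖ₑ ∂(iidLaw n ν)) with he
  set r : ℕ → ℝ≥0∞ := fun n => ⨆ ν ∈ P n, max (Rc1 ν (f n)) (max (Rc2 ν (f n)) (Rc3 ν (f n)))
    with hr
  have main : ∀ δ : ℝ, 0 < δ → ∃ C : ℝ≥0∞, C ≠ ⊤ ∧ ∀ᶠ n in atTop,
      ∀ ν ∈ {ν ∈ P n | mean ν ∈ A n}, Integrable (g n) (iidLaw n ν) ∧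
        missProb ν (g n) (t n) δ ≤ ENNReal.ofReal α + C * (e n + 22 * r n) := by
    intro δ hδ
    obtain ⟨C, hC, key⟩ := exists_missProb_le hδ
    refine ⟨C, hC, ?_⟩
    -- A positive `n` makes the index law a probability measure. Convergence to zero eventually
    -- makes the approximation error finite and the smoothness error at most 1.
    filter_upwards [eventually_gt_atTop 0, happrox.eventually_lt_const ENNReal.zero_lt_top,
      hsmooth.eventually_le_const zero_lt_one] with n hn h1 h2 ν hν
    have : NeZero n := ⟨hn.ne'⟩
    refine key (hP n ν hν.1) (hf n) (hg n) (ht_meas n ν hν.1) ?_ h2 ?_ h1.ne ?_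
    · filter_upwards [ht n ν hν.1] with x hx
      -- Membership in the restricted class gives `mean ν ∈ A n`, so the unknown true mean is one of
      -- the centres covered by the guarantee.
      exact (le_iSup₂ (f := fun μ (_ : μ ∈ A n) => bootTail (g n) μ x (t n x))
        (mean ν) hν.2).trans hx
    · exact le_iSup₂ (f := fun ν (_ : ν ∈ P n) =>
        max (Rc1 ν (f n)) (max (Rc2 ν (f n)) (Rc3 ν (f n)))) ν hν.1
    · exact le_iSup₂ (f := fun ν (_ : ν ∈ P n) =>
        ((∫⁻ ω, ‖f n (centeredResample (mean ν) ω.1 ω.2.1)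
            - g n (centeredResample (mean ν) ω.1 ω.2.1)‖ₑ ∂(jointLaw n ν))
        + ∫⁻ x, ‖f n x - g n x‖ₑ ∂(iidLaw n ν))) ν hν.1
  refine ⟨?_, ?_⟩
  · obtain ⟨C, -, h⟩ := main 1 one_pos
    filter_upwards [h] with n hn ν hν
    exact (hn ν hν).1
  have lim : ∀ δ : ℝ, 0 < δ →
      limsup (fun n => ⨆ ν ∈ {ν ∈ P n | mean ν ∈ A n}, missProb ν (g n) (t n) δ) atTop
        ≤ ENNReal.ofReal α := by
    intro δ hδ
    obtain ⟨C, hC, h⟩ := main δ hδ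
    have ht0 : Tendsto (fun n => ENNReal.ofReal α + C * (e n + 22 * r n)) atTop
        (𝓝 (ENNReal.ofReal α)) := by
      have h22 := ENNReal.Tendsto.const_mul (a := 22) hsmooth (Or.inr (by simp))
      have := ENNReal.Tendsto.const_mul (happrox.add h22) (Or.inr hC)
      simpa using this.const_add (ENNReal.ofReal α)
    rw [← ht0.limsup_eq]
    refine limsup_le_limsup ?_
    filter_upwards [h] with n hn
    exact iSup₂_le fun ν hν => (hn ν hν).2
  -- The bound by `α` holds for every fixed `δ > 0`, so the behaviour of the constant `C` as `δ`
  -- tends to zero plays no role.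
  refine (liminf_le_limsup).trans (limsup_le_of_le (h := ?_))
  filter_upwards [self_mem_nhdsWithin] with δ hδ
  exact lim δ hδ
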